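/- Let $\alpha>0$, $\mu_P(\alpha)=\frac{2}{\alpha}\sqrt{1+\alpha}$, $\mu_C(\alpha)=\frac{4}{\alpha}\sqrt{\frac{\alpha+1}{3}}$, and $\mu>\mu_P(\alpha)$. Put $$b(\theta,\phi)=-1+\phi^2\sin\theta,\quad p_+(\theta)=1+\alpha\cos^2\theta-\mu\alpha\sin\theta\cos\theta,\quad c_+(\theta)=-\alpha(\cos\theta-\mu\sin\theta),$$ and consider the reduced rigid-body system of a slipping rod $$\dot\theta=\phi,\qquad \dot\phi=-\frac{c_+(\theta)\,b(\theta,\phi)}{p_+(\theta)}. \qquad (1)$$ In the new time $\tau$ with $d\tau/dt=1/p_+(\theta)$ it becomes $$\frac{d\theta}{d\tau}=p_+(\theta)\phi,\qquad \frac{d\phi}{d\tau}=-c_+(\theta)\,b(\theta,\phi). \qquad (2)$$ Let $\theta_1=\arctan\frac12\bigl(\mu\alpha-\sqrt{\mu^2\alpha^2-4(1+\alpha)}\bigr)$, $\phi_1^+=\sqrt{\csc\theta_1}$, $P=(\theta_1,\phi_1^+)$, and $$\lambda_1=p_+'(\theta_1)\phi_1^+,\quad \lambda_2=-c_+(\theta_1)\,\partial_\phi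 b(\theta_1,\phi_1^+),\quad \xi=\lambda_1^{-1}\lambda_2,\quad s=-\lambda_1^{-1}(\phi_1^+)^2 .$$ (a) One has $b(P)=0$ and $p_+(\theta_1)=0$, and $P$ is a stable node of (2): an equilibrium at which all eigenvalues of the linearization are real and negative. Moreover $\lambda_1,\lambda_2<0$, $\xi>0$, $s>0$, the vectors $(1-\xi,s)$ and $(0,1)$ are eigenvectors of the linearization of (2) at $P$ for $\lambda_1$ and $\lambda_2$, and $\mu>\mu_C(\alpha)$ if and only if $\xi<1$. (b) Every neighborhood of $P$ contains a neighborhood $\mathcal U$ of $P$ such that every forward orbit of (2) starting in $\mathcal U$ stays in $\mathcal U$ and converges to $P$ as $\tau\to\infty$, and such that, with $$\mathcal T=\{b<0,\ p_+>0\}\cap\mathcal U,\qquad \mathcal F=\{b>0,\ p_+<0\}\cap\mathcal U,$$ the following holds if $\mu>\mu_C(\alpha)$. There are $c>0$ with $|\theta-\theta_1|\le c$ on $\mathcal U$ and a $C^\infty$ function $m_{ss}:[\theta_1-c,\theta_1+c]\to\mathbb R$ whose graph $\gamma^s$ is the strong stable manifold of $P$ in $\mathcal U$, that is, the set of points whose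 forward orbit under (2) stays in $\mathcal U$ and satisfies $(\theta,\phi)(\tau)-P=o(e^{\lambda_2\tau})$ as $\tau\to\infty$. Furthermore: 1. $\gamma^s\subset\mathcal T\cup\{P\}\cup\mathcal F$, and $m_{ss}(\theta)=\phi_1^++(1-\xi)^{-1}s\,(\theta-\theta_1)+\mathcal O((\theta-\theta_1)^2)$ on $[\theta_1-c,\theta_1+c]$; so $\gamma^s$ passes through $P$ tangent to $(1-\xi,s)$. 2. The forward orbit under (1) of every $(\theta,\phi)\in\mathcal T$ with $\phi>m_{ss}(\theta)$ stays in $\mathcal T$ until, at a finite time $t$, it crosses inside $\mathcal U$ the boundary $b=0$ into $b>0$, at a point with $p_+>0$ (lift-off). 3. The forward orbit under (1) of every $(\theta,\phi)\in\mathcal T$ with $\phi<m_{ss}(\theta)$ stays in $\mathcal T$ until, at a finite time $t$, it reaches $P$, tangent to the line $\theta=\theta_1$, on which $p_+=0$. -/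

import Mathlib

open Set Filter Topology Asymptotics
open scoped ContDiff

namespace PainleveRod

noncomputable section

/-! ### Coefficients of the rod equations, slipping to the right (`v > 0`), on the `(θ, φ)`-plane -/

/-- Free vertical acceleration of the contact point: `b(θ, φ) = -1 + φ² sin θ`. -/
def b (θ φ : ℝ) : ℝ := -1 + φ ^ 2 * Real.sin θ

/-- `p₊(θ) = 1 + α cos² θ - μ α sin θ cos θ`. -/
def pPlus (α μ θ : ℝ) : ℝ :=
  1 + α * Real.cos θ ^ 2 - μ * α * Real.sin θ * Real.cos θ

/-- `c₊(θ) = -α (cos θ - μ sin θ)`. -/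
def cPlus (α μ θ : ℝ) : ℝ := -α * (Real.cos θ - μ * Real.sin θ)

/-- The reduced rigid-body vector field in the original time `t`:
`θ' = φ`, `φ' = -c₊(θ) b(θ, φ) / p₊(θ)`. It is meaningful only where `p₊(θ) ≠ 0`. -/
def reducedField (α μ : ℝ) (x : ℝ × ℝ) : ℝ × ℝ :=
  (x.2, -(cPlus α μ x.1 * b x.1 x.2) / pPlus α μ x.1)

/-- The vector field in the new time `τ`, `dτ/dt = 1 / p₊(θ)`:
`dθ/dτ = p₊(θ) φ`, `dφ/dτ = -c₊(θ) b(θ, φ)`. -/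
def desingularizedField (α μ : ℝ) (x : ℝ × ℝ) : ℝ × ℝ :=
  (pPlus α μ x.1 * x.2, -(cPlus α μ x.1 * b x.1 x.2))

/-- Critical friction coefficient for the Painlevé paradox, `μ_P(α) = (2/α) √(1+α)`. -/
def muP (α : ℝ) : ℝ := 2 / α * Real.sqrt (1 + α)

/-- `μ_C(α) = (4/α) √((α+1)/3)`. -/
def muC (α : ℝ) : ℝ := 4 / α * Real.sqrt ((α + 1) / 3)

/-- The smaller zero of `p₊` in `(0, π/2)`:
`θ₁ = arctan (½ (μα - √(μ²α² - 4(1+α))))`. -/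
def theta1 (α μ : ℝ) : ℝ :=
  Real.arctan (1 / 2 * (μ * α - Real.sqrt (μ ^ 2 * α ^ 2 - 4 * (1 + α))))

/-- `φ₁⁺ = √(csc θ₁)`. -/
def phi1 (α μ : ℝ) : ℝ := Real.sqrt (1 / Real.sin (theta1 α μ))

/-- The singular point `P = (θ₁, √(csc θ₁))`. -/
def pointP (α μ : ℝ) : ℝ × ℝ := (theta1 α μ, phi1 α μ)

/-- `λ₁ = p₊'(θ₁) φ₁⁺`. -/
def lam1 (α μ : ℝ) : ℝ := deriv (pPlus α μ) (theta1 α μ) * phi1 α μ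

/-- `λ₂ = -c₊(θ₁) ∂_φ b(θ₁, φ₁⁺)`. -/
def lam2 (α μ : ℝ) : ℝ :=
  -cPlus α μ (theta1 α μ) * deriv (fun φ => b (theta1 α μ) φ) (phi1 α μ)

/-- `ξ = λ₂ / λ₁`. -/
def xi (α μ : ℝ) : ℝ := (lam1 α μ)⁻¹ * lam2 α μ

/-- `s = -(φ₁⁺)² / λ₁`. -/
def sCoeff (α μ : ℝ) : ℝ := -(lam1 α μ)⁻¹ * phi1 α μ ^ 2

/-- The region `𝓣` in a neighbourhood `U` of `P`: `b < 0`, `p₊ > 0`. -/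
def regionT (α μ : ℝ) (U : Set (ℝ × ℝ)) : Set (ℝ × ℝ) :=
  {x | b x.1 x.2 < 0 ∧ 0 < pPlus α μ x.1} ∩ U

/-- The region `𝓕` in a neighbourhood `U` of `P`: `b > 0`, `p₊ < 0`. -/
def regionF (α μ : ℝ) (U : Set (ℝ × ℝ)) : Set (ℝ × ℝ) :=
  {x | 0 < b x.1 x.2 ∧ pPlus α μ x.1 < 0} ∩ U

/-! ### Dynamical notions for planar vector fields -/

/-- `X` solves `X' = V(X)` on the time set `I` (one-sided derivatives at included end points). -/
def IsSolutionOn (V : ℝ × ℝ → ℝ × ℝ) (X : ℝ → ℝ × ℝ) (I : Set ℝ) : Prop :=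
  ∀ t ∈ I, HasDerivWithinAt X (V (X t)) I t

/-- A stable node: an equilibrium of a `C¹` vector field all of whose (complex) eigenvalues of the
linearization are real and negative. -/
structure IsStableNode (V : ℝ × ℝ → ℝ × ℝ) (p : ℝ × ℝ) : Prop where
  contDiffAt : ContDiffAt ℝ 1 V p
  equilibrium : V p = 0
  real_negative : ∀ z : ℂ,
    Polynomial.aeval z (LinearMap.charpoly (fderiv ℝ V p : ℝ × ℝ →ₗ[ℝ] ℝ × ℝ)) = 0 →
      z.im = 0 ∧ z.re < 0

/-- The local strong stable set in `U` of an equilibrium `p` whose weak stable eigenvalue is `r`: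
the points whose forward orbit stays in `U` and converges to `p` faster than `exp (r τ)`. -/
def localStrongStableSet (V : ℝ × ℝ → ℝ × ℝ) (p : ℝ × ℝ) (r : ℝ) (U : Set (ℝ × ℝ)) :
    Set (ℝ × ℝ) :=
  {x | ∃ X : ℝ → ℝ × ℝ, X 0 = x ∧ IsSolutionOn V X (Ici 0) ∧ (∀ τ ∈ Ici (0 : ℝ), X τ ∈ U) ∧
    (fun τ => X τ - p) =o[atTop] fun τ => Real.exp (r * τ)}

/-- The forward orbit of `x` (original time) stays in `𝓣` until it meets, inside `U`, the boundary
`b = 0` at a point with `p₊ > 0`, and crosses there into `b > 0` (lift-off). -/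
def LeavesThroughLiftOff (α μ : ℝ) (U : Set (ℝ × ℝ)) (x : ℝ × ℝ) : Prop :=
  ∃ (X : ℝ → ℝ × ℝ) (t₁ t₂ : ℝ), 0 < t₁ ∧ t₁ < t₂ ∧ X 0 = x ∧
    IsSolutionOn (reducedField α μ) X (Ico 0 t₂) ∧
    (∀ t ∈ Ico 0 t₁, X t ∈ regionT α μ U) ∧
    (X t₁ ∈ U ∧ b (X t₁).1 (X t₁).2 = 0 ∧ 0 < pPlus α μ (X t₁).1) ∧
    (∀ t ∈ Ioo t₁ t₂, 0 < b (X t).1 (X t).2 ∧ 0 < pPlus α μ (X t).1)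

/-- The forward orbit of `x` (original time) stays in `𝓣` until, at a finite time, it reaches `P`,
tangentially to the vertical line `θ = θ₁`, on which `p₊ = 0`. -/
def LeavesThroughPVertically (α μ : ℝ) (U : Set (ℝ × ℝ)) (x : ℝ × ℝ) : Prop :=
  ∃ (X : ℝ → ℝ × ℝ) (t₁ : ℝ), 0 < t₁ ∧ X 0 = x ∧
    IsSolutionOn (reducedField α μ) X (Ico 0 t₁) ∧
    (∀ t ∈ Ico 0 t₁, X t ∈ regionT α μ U) ∧
    Tendsto X (𝓝[<] t₁) (𝓝 (pointP α μ)) ∧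
    (fun t => (X t).1 - theta1 α μ) =o[𝓝[<] t₁] fun t => (X t).2 - phi1 α μ

end

end PainleveRod

open PainleveRod

/-!
The quantity `w = φ²` makes the problem linear. In the time `σ` with `dσ/dτ = φ` the system reads
`θ' = p₊(θ)`, `w' = a(θ) (1 / sin θ - w)` with `a = 2 c₊ sin θ`: the angle moves autonomously, and
`w` relaxes towards the curve `b = 0` at the rate `a`. In the slope `u = tan θ` the first equation
is the logistic equation `u' = (u - u₁) (u - u₁ - D)`, where `u₁ = tan θ₁` and
`D = √(μ²α² - 4(1+α))` (`gap`), so it is solved explicitly (`exists_angle_solution`); hence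
`θ - θ₁ = O(exp (-D σ))`. At `θ₁` the rate `a` equals `2 u₁`, and `ξ = 2 u₁ / D`. The times `τ` and
`t` are recovered by a change of time (`exists_time_change`).

A small rectangle around `P` is forward invariant as soon as it contains the part of the curve
`φ² = 1 / sin θ` over its base, because `w` moves towards that curve, and all its orbits tend to
`P` (`exists_orbit`).

For `ξ < 1` the linear equation `p₊ M' = a (1 / sin θ - M)`, which is singular at `θ₁`, has a
smooth solution `M`: it is `1 / sin θ` plus a term which in the slope variable `x = u - u₁` is
given by an integral `∫₀¹ t^(-ξ) h(tx) dt` with smooth `h` (`exists_invariant_curve`). The defect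
`y = φ² - M(θ)` then satisfies `y' = -a y`, so it keeps its sign and, near `P`, decays about like
`exp (-2 u₁ σ)`, that is `exp (λ₂ τ)`. Everything follows from comparing this rate with the faster
rate `D` of `θ - θ₁`.

* The graph of `m = √M` is the strong stable manifold: on it `y = 0` and the orbit is controlled by
  `θ - θ₁`, while off it `y` decays no faster than `exp (λ₂ τ)` (`image_curve_eq`).
* Above the graph and to the left of `θ₁`, `y > 0` eventually exceeds the distance, of order
  `|θ - θ₁|`, between the curves `φ² = M(θ)` and `b = 0`, so the orbit crosses `b = 0`; it does so
  once, because `b` times an integrating factor is increasing (`leavesThroughLiftOff_of_lt`).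
* Below the graph `φ² < M(θ) < 1 / sin θ`, so the orbit remains in `b < 0`; the time `t` to reach
  `P` is finite because `dθ/dt = φ` is bounded below, and the limit is tangent to `θ = θ₁` because
  `y` dominates `θ - θ₁` (`leavesThroughPVertically_of_lt`).
-/

namespace PainleveRod

noncomputable section

/-! ### The coefficients in terms of the slope `tan θ` -/

/-- The distance `√(μ²α² - 4(1+α))` between the two zeros of
`u ↦ u² - μαu + 1 + α`, that is, of `p₊` as a function of the slope `u = tan θ`. -/
def gap (α μ : ℝ) : ℝ := Real.sqrt (μ ^ 2 * α ^ 2 - 4 * (1 + α))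

/-- The slope `tan θ₁`, the smaller zero of `u ↦ u² - μαu + 1 + α`. -/
def slope (α μ : ℝ) : ℝ := 1 / 2 * (μ * α - gap α μ)

/-- The coefficient `2 c₊(θ) sin θ`: along orbits, in the time `σ` with `dσ/dt = φ / p₊`, the
quantity `φ²` relaxes towards `1 / sin θ` at this rate. -/
def relaxRate (α μ θ : ℝ) : ℝ := 2 * cPlus α μ θ * Real.sin θ

lemma mu_pos {α μ : ℝ} (hα : 0 < α) (hμ : muP α < μ) : 0 < μ :=
  lt_of_le_of_lt (by unfold muP; positivity) hμ

lemma discrim_pos {α μ : ℝ} (hα : 0 < α) (hμ : muP α < μ) :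
    0 < μ ^ 2 * α ^ 2 - 4 * (1 + α) := by
  have h : 2 * Real.sqrt (1 + α) < μ * α := by
    have := mul_lt_mul_of_pos_right hμ hα
    unfold muP at this
    field_simp at this
    linarith
  have h0 : 0 ≤ 2 * Real.sqrt (1 + α) := by positivity
  have h1 : (2 * Real.sqrt (1 + α)) ^ 2 < (μ * α) ^ 2 := by gcongr
  rw [mul_pow, Real.sq_sqrt (by linarith)] at h1
  linarith

lemma gap_pos {α μ : ℝ} (hα : 0 < α) (hμ : muP α < μ) : 0 < gap α μ :=
  Real.sqrt_pos.2 (discrim_pos hα hμ)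

lemma gap_sq {α μ : ℝ} (hα : 0 < α) (hμ : muP α < μ) :
    gap α μ ^ 2 = μ ^ 2 * α ^ 2 - 4 * (1 + α) :=
  Real.sq_sqrt (discrim_pos hα hμ).le

lemma two_mul_slope (α μ : ℝ) : 2 * slope α μ + gap α μ = μ * α := by
  unfold slope; ring

lemma slope_pos {α μ : ℝ} (hα : 0 < α) (hμ : muP α < μ) : 0 < slope α μ := by
  have h : gap α μ < μ * α := by
    refine lt_of_pow_lt_pow_left₀ 2 (mul_pos (mu_pos hα hμ) hα).le ?_
    rw [gap_sq hα hμ]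
    nlinarith
  unfold slope
  linarith

lemma slope_mul {α μ : ℝ} (hα : 0 < α) (hμ : muP α < μ) :
    slope α μ * (slope α μ + gap α μ) = 1 + α := by
  have := gap_sq hα hμ
  unfold slope
  linear_combination (-1 / 4 : ℝ) * this

lemma theta1_eq (α μ : ℝ) : theta1 α μ = Real.arctan (slope α μ) := rfl

lemma tan_theta1 (α μ : ℝ) : Real.tan (theta1 α μ) = slope α μ := Real.tan_arctan _

lemma theta1_pos {α μ : ℝ} (hα : 0 < α) (hμ : muP α < μ) : 0 < theta1 α μ := by
  rw [theta1_eq]; exact Real.arctan_pos.2 (slope_pos hα hμ)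

lemma theta1_lt (α μ : ℝ) : theta1 α μ < Real.pi / 2 := Real.arctan_lt_pi_div_two _

lemma cos_theta1_pos (α μ : ℝ) : 0 < Real.cos (theta1 α μ) := Real.cos_arctan_pos _

lemma sin_theta1_pos {α μ : ℝ} (hα : 0 < α) (hμ : muP α < μ) : 0 < Real.sin (theta1 α μ) :=
  Real.sin_pos_of_pos_of_lt_pi (theta1_pos hα hμ)
    ((theta1_lt α μ).trans (by linarith [Real.pi_pos]))

lemma sin_theta1 (α μ : ℝ) :
    Real.sin (theta1 α μ) = slope α μ * Real.cos (theta1 α μ) := by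
  rw [← tan_theta1, Real.tan_mul_cos (cos_theta1_pos α μ).ne']

/-- `p₊` factors as a quadratic polynomial in the slope `tan θ`. -/
lemma pPlus_eq {α μ θ : ℝ} (hα : 0 < α) (hμ : muP α < μ) (hθ : Real.cos θ ≠ 0) :
    pPlus α μ θ = Real.cos θ ^ 2 *
      ((Real.tan θ - slope α μ) * (Real.tan θ - slope α μ - gap α μ)) := by
  have h1 := slope_mul hα hμ
  have h2 := two_mul_slope α μ
  have h3 := Real.sin_sq_add_cos_sq θ
  have h4 := Real.tan_mul_cos hθ
  unfold pPlus
  rw [← h4] at h3 ⊢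
  linear_combination (-1 : ℝ) * h3 - Real.cos θ ^ 2 * h1 + Real.cos θ ^ 2 * Real.tan θ * h2

lemma pPlus_theta1 {α μ : ℝ} (hα : 0 < α) (hμ : muP α < μ) : pPlus α μ (theta1 α μ) = 0 := by
  rw [pPlus_eq hα hμ (cos_theta1_pos α μ).ne', tan_theta1]; ring

lemma hasDerivAt_pPlus (α μ θ : ℝ) :
    HasDerivAt (pPlus α μ) (-(2 * α * Real.cos θ * Real.sin θ) -
      μ * α * (Real.cos θ ^ 2 - Real.sin θ ^ 2)) θ := by
  have h1 := Real.hasDerivAt_cos θ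
  have h2 := Real.hasDerivAt_sin θ
  have := (((h1.pow 2).const_mul α).const_add 1).sub ((h2.const_mul (μ * α)).mul h1)
  exact this.congr_deriv (by push_cast; ring)

lemma deriv_pPlus_theta1 {α μ : ℝ} (hα : 0 < α) (hμ : muP α < μ) :
    deriv (pPlus α μ) (theta1 α μ) = -gap α μ := by
  rw [(hasDerivAt_pPlus α μ _).deriv]
  have h1 := slope_mul hα hμ
  have h2 := two_mul_slope α μ
  have h3 := Real.sin_sq_add_cos_sq (theta1 α μ)
  rw [sin_theta1] at h3 ⊢
  have h5 : (1 + slope α μ ^ 2) * Real.cos (theta1 α μ) ^ 2 = 1 := by linear_combination h3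
  generalize Real.cos (theta1 α μ) = c at *
  generalize slope α μ = u at *
  generalize gap α μ = D at *
  linear_combination (-D) * h5 + (c ^ 2 * (1 - u ^ 2)) * h2 + 2 * c ^ 2 * u * h1

/-- The coefficient `c₊` at `θ₁` equals `1 / cos θ₁`. -/
lemma cPlus_theta1 {α μ : ℝ} (hα : 0 < α) (hμ : muP α < μ) :
    cPlus α μ (theta1 α μ) * Real.cos (theta1 α μ) = 1 := by
  have h1 := slope_mul hα hμ
  have h2 := two_mul_slope α μ
  have h3 := Real.sin_sq_add_cos_sq (theta1 α μ)
  unfold cPlus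
  rw [sin_theta1] at h3 ⊢
  generalize Real.cos (theta1 α μ) = c at *
  generalize slope α μ = u at *
  generalize gap α μ = D at *
  linear_combination h3 + c ^ 2 * h1 - u * c ^ 2 * h2

lemma relaxRate_theta1 {α μ : ℝ} (hα : 0 < α) (hμ : muP α < μ) :
    relaxRate α μ (theta1 α μ) = 2 * slope α μ := by
  unfold relaxRate
  rw [sin_theta1]
  linear_combination 2 * slope α μ * cPlus_theta1 hα hμ

lemma phi1_pos {α μ : ℝ} (hα : 0 < α) (hμ : muP α < μ) : 0 < phi1 α μ :=
  Real.sqrt_pos.2 (one_div_pos.2 (sin_theta1_pos hα hμ))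

lemma phi1_sq {α μ : ℝ} (hα : 0 < α) (hμ : muP α < μ) :
    phi1 α μ ^ 2 = 1 / Real.sin (theta1 α μ) :=
  Real.sq_sqrt (one_div_pos.2 (sin_theta1_pos hα hμ)).le

lemma phi1_sq_mul {α μ : ℝ} (hα : 0 < α) (hμ : muP α < μ) :
    phi1 α μ ^ 2 * Real.sin (theta1 α μ) = 1 := by
  rw [phi1_sq hα hμ, one_div_mul_cancel (sin_theta1_pos hα hμ).ne']

lemma b_pointP {α μ : ℝ} (hα : 0 < α) (hμ : muP α < μ) : b (theta1 α μ) (phi1 α μ) = 0 := by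
  unfold b; rw [phi1_sq_mul hα hμ]; ring

lemma lam1_eq {α μ : ℝ} (hα : 0 < α) (hμ : muP α < μ) :
    lam1 α μ = -(gap α μ * phi1 α μ) := by
  unfold lam1; rw [deriv_pPlus_theta1 hα hμ]; ring

lemma hasDerivAt_b_right (θ φ : ℝ) :
    HasDerivAt (fun φ => b θ φ) (2 * φ * Real.sin θ) φ := by
  unfold b
  simpa using (((hasDerivAt_id φ).pow 2).mul_const (Real.sin θ)).const_add (-1)

lemma lam2_eq {α μ : ℝ} (hα : 0 < α) (hμ : muP α < μ) :
    lam2 α μ = -(2 * slope α μ * phi1 α μ) := by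
  unfold lam2
  rw [(hasDerivAt_b_right _ _).deriv, ← relaxRate_theta1 hα hμ, relaxRate]
  ring

lemma lam1_neg {α μ : ℝ} (hα : 0 < α) (hμ : muP α < μ) : lam1 α μ < 0 := by
  rw [lam1_eq hα hμ]; exact neg_lt_zero.2 (mul_pos (gap_pos hα hμ) (phi1_pos hα hμ))

lemma lam2_neg {α μ : ℝ} (hα : 0 < α) (hμ : muP α < μ) : lam2 α μ < 0 := by
  rw [lam2_eq hα hμ]
  have := slope_pos hα hμ
  have := phi1_pos hα hμ
  exact neg_lt_zero.2 (by positivity)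

lemma xi_eq {α μ : ℝ} (hα : 0 < α) (hμ : muP α < μ) :
    xi α μ = 2 * slope α μ / gap α μ := by
  have h1 := (gap_pos hα hμ).ne'
  have h2 := (phi1_pos hα hμ).ne'
  unfold xi
  rw [lam1_eq hα hμ, lam2_eq hα hμ]
  field_simp

lemma xi_pos {α μ : ℝ} (hα : 0 < α) (hμ : muP α < μ) : 0 < xi α μ := by
  rw [xi_eq hα hμ]
  exact div_pos (by linarith [slope_pos hα hμ]) (gap_pos hα hμ)

lemma sCoeff_eq {α μ : ℝ} (hα : 0 < α) (hμ : muP α < μ) :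
    sCoeff α μ = phi1 α μ / gap α μ := by
  have h1 := (gap_pos hα hμ).ne'
  have h2 := (phi1_pos hα hμ).ne'
  unfold sCoeff
  rw [lam1_eq hα hμ]
  field_simp

lemma sCoeff_pos {α μ : ℝ} (hα : 0 < α) (hμ : muP α < μ) : 0 < sCoeff α μ := by
  rw [sCoeff_eq hα hμ]; exact div_pos (phi1_pos hα hμ) (gap_pos hα hμ)

lemma xi_lt_one_iff {α μ : ℝ} (hα : 0 < α) (hμ : muP α < μ) :
    xi α μ < 1 ↔ 2 * slope α μ < gap α μ := by
  rw [xi_eq hα hμ, div_lt_one (gap_pos hα hμ)]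

lemma muC_lt_iff_xi_lt_one {α μ : ℝ} (hα : 0 < α) (hμ : muP α < μ) :
    muC α < μ ↔ xi α μ < 1 := by
  have hg := gap_pos hα hμ
  have hm := mul_pos (mu_pos hα hμ) hα
  have h2 := two_mul_slope α μ
  have e1 : xi α μ < 1 ↔ (μ * α) ^ 2 < (2 * gap α μ) ^ 2 := by
    rw [xi_lt_one_iff hα hμ, pow_lt_pow_iff_left₀ hm.le (by positivity) two_ne_zero]
    constructor <;> intro h <;> linarith
  have e2 : muC α < μ ↔ (4 * Real.sqrt ((α + 1) / 3)) ^ 2 < (μ * α) ^ 2 := by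
    rw [pow_lt_pow_iff_left₀ (by positivity) hm.le two_ne_zero, ← div_lt_iff₀ hα]
    unfold muC
    rw [div_mul_eq_mul_div]
  rw [e1, e2, mul_pow, mul_pow 2, gap_sq hα hμ, Real.sq_sqrt (by positivity)]
  constructor <;> intro h <;> nlinarith

/-! ### The linearization at `P` -/

lemma contDiff_desingularizedField (α μ : ℝ) {n : WithTop ℕ∞} :
    ContDiff ℝ n (desingularizedField α μ) := by
  unfold desingularizedField pPlus cPlus b
  fun_prop

lemma hasDerivAt_cPlus (α μ θ : ℝ) :
    HasDerivAt (cPlus α μ) (-α * (-Real.sin θ - μ * Real.cos θ)) θ :=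
  ((Real.hasDerivAt_cos θ).sub ((Real.hasDerivAt_sin θ).const_mul μ)).const_mul (-α)

/-- The linearization at `P`; the lower left entry is `-c₊ φ² cos θ`, and `c₊ cos θ = 1` at `P`. -/
lemma fderiv_desingularizedField_apply {α μ : ℝ} (hα : 0 < α) (hμ : muP α < μ) (v : ℝ × ℝ) :
    fderiv ℝ (desingularizedField α μ) (pointP α μ) v =
      (lam1 α μ * v.1, -phi1 α μ ^ 2 * v.1 + lam2 α μ * v.2) := by
  have hf : HasFDerivAt (Prod.fst : ℝ × ℝ → ℝ) (ContinuousLinearMap.fst ℝ ℝ ℝ) (pointP α μ) :=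
    hasFDerivAt_fst
  have hs : HasFDerivAt (Prod.snd : ℝ × ℝ → ℝ) (ContinuousLinearMap.snd ℝ ℝ ℝ) (pointP α μ) :=
    hasFDerivAt_snd
  have hp := ((hasDerivAt_pPlus α μ (pointP α μ).1).differentiableAt.hasDerivAt).comp_hasFDerivAt
    (pointP α μ) hf
  have hc := (hasDerivAt_cPlus α μ (pointP α μ).1).comp_hasFDerivAt (pointP α μ) hf
  have hsin := (Real.hasDerivAt_sin (pointP α μ).1).comp_hasFDerivAt (pointP α μ) hf
  have hb := (((hs.pow 2).mul hsin).const_add (-1))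
  have key := (hp.mul hs).prodMk (hc.mul hb).neg
  have key' : HasFDerivAt (desingularizedField α μ) _ (pointP α μ) := key
  rw [key'.fderiv]
  have h1 := phi1_sq_mul hα hμ
  have h2 := cPlus_theta1 hα hμ
  have h3 := pPlus_theta1 hα hμ
  have h4 := deriv_pPlus_theta1 hα hμ
  have h5 := relaxRate_theta1 hα hμ
  unfold relaxRate at h5
  rw [lam1_eq hα hμ, lam2_eq hα hμ]
  ext
  · simp [pointP, h3, h4]
    ring
  · simp [pointP, h1]
    linear_combination (-phi1 α μ ^ 2 * v.1) * h2 - phi1 α μ * v.2 * h5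

lemma isStableNode_pointP {α μ : ℝ} (hα : 0 < α) (hμ : muP α < μ) :
    IsStableNode (desingularizedField α μ) (pointP α μ) where
  contDiffAt := (contDiff_desingularizedField α μ).contDiffAt
  equilibrium := by
    simp [desingularizedField, pointP, pPlus_theta1 hα hμ, b_pointP hα hμ]
  real_negative := by
    intro z hz
    set A : ℝ × ℝ →ₗ[ℝ] ℝ × ℝ := (fderiv ℝ (desingularizedField α μ) (pointP α μ) :
      ℝ × ℝ →ₗ[ℝ] ℝ × ℝ) with hA
    have e : LinearMap.toMatrix (Module.Basis.finTwoProd ℝ) (Module.Basis.finTwoProd ℝ) A =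
        !![lam1 α μ, 0; -phi1 α μ ^ 2, lam2 α μ] := by
      ext i j
      rw [LinearMap.toMatrix_apply, hA, ContinuousLinearMap.coe_coe,
        fderiv_desingularizedField_apply hα hμ]
      fin_cases i <;> fin_cases j <;> simp
    rw [← LinearMap.charpoly_toMatrix A (Module.Basis.finTwoProd ℝ), e,
      Matrix.charpoly_fin_two] at hz
    have h : (z - lam1 α μ) * (z - lam2 α μ) = 0 := by
      simp [Matrix.trace_fin_two, Matrix.det_fin_two] at hz
      linear_combination hz
    rcases mul_eq_zero.1 h with h | h
    · rw [sub_eq_zero.1 h]; exact ⟨Complex.ofReal_im _, by simpa using lam1_neg hα hμ⟩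
    · rw [sub_eq_zero.1 h]; exact ⟨Complex.ofReal_im _, by simpa using lam2_neg hα hμ⟩

lemma hasEigenvector_lam1 {α μ : ℝ} (hα : 0 < α) (hμ : muP α < μ) :
    Module.End.HasEigenvector
      (fderiv ℝ (desingularizedField α μ) (pointP α μ) : ℝ × ℝ →ₗ[ℝ] ℝ × ℝ)
      (lam1 α μ) (1 - xi α μ, sCoeff α μ) := by
  refine Module.End.hasEigenvector_iff.2 ⟨Module.End.mem_eigenspace_iff.2 ?_, ?_⟩
  · rw [ContinuousLinearMap.coe_coe, fderiv_desingularizedField_apply hα hμ]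
    have h := (lam1_neg hα hμ).ne
    ext
    · simp
    · simp only [Prod.smul_mk, smul_eq_mul, xi, sCoeff]
      field_simp
      ring
  · intro h
    exact (sCoeff_pos hα hμ).ne' (congrArg Prod.snd h)

lemma hasEigenvector_lam2 {α μ : ℝ} (hα : 0 < α) (hμ : muP α < μ) :
    Module.End.HasEigenvector
      (fderiv ℝ (desingularizedField α μ) (pointP α μ) : ℝ × ℝ →ₗ[ℝ] ℝ × ℝ)
      (lam2 α μ) (0, 1) := by
  refine Module.End.hasEigenvector_iff.2 ⟨Module.End.mem_eigenspace_iff.2 ?_, ?_⟩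
  · rw [ContinuousLinearMap.coe_coe, fderiv_desingularizedField_apply hα hμ]
    simp
  · intro h
    exact one_ne_zero (congrArg Prod.snd h)

/-! ### Scalar linear equations on a half-line -/

lemma monotoneOn_Ici_of_hasDerivWithinAt_nonneg {f f' : ℝ → ℝ} {N : ℝ}
    (hf : ∀ σ ∈ Ici N, HasDerivWithinAt f (f' σ) (Ici N) σ)
    (h0 : ∀ σ ∈ Ici N, 0 ≤ f' σ) : MonotoneOn f (Ici N) := by
  refine monotoneOn_of_hasDerivWithinAt_nonneg (convex_Ici N)
    (fun σ hσ => (hf σ hσ).continuousWithinAt) (f' := f') ?_ ?_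
  · intro σ hσ
    exact (hf σ (interior_subset hσ)).mono interior_subset
  · intro σ hσ
    exact h0 σ (interior_subset hσ)

/-- An antiderivative on `[0, ∞)` of a function which is continuous there. -/
lemma exists_antideriv_Ici {a : ℝ → ℝ} (ha : ContinuousOn a (Ici 0)) :
    ∃ A : ℝ → ℝ, A 0 = 0 ∧ ∀ σ ∈ Ici (0 : ℝ), HasDerivAt A (a σ) σ := by
  have hc : Continuous fun σ => a (max σ 0) :=
    ha.comp_continuous (by fun_prop) fun σ => le_max_right σ 0
  refine ⟨fun σ => ∫ r in (0 : ℝ)..σ, a (max r 0), by simp, fun σ hσ => ?_⟩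
  have h := hc.integral_hasStrictDerivAt 0 σ
  simp only [max_eq_left (mem_Ici.1 hσ)] at h
  exact h.hasDerivAt

/-- Variation of constants for `w' = a (e - w)`. -/
lemma exists_linear_solution {a e : ℝ → ℝ} (ha : ContinuousOn a (Ici 0))
    (he : ContinuousOn e (Ici 0)) (w₀ : ℝ) :
    ∃ w : ℝ → ℝ, w 0 = w₀ ∧
      ∀ σ ∈ Ici (0 : ℝ), HasDerivWithinAt w (a σ * (e σ - w σ)) (Ici 0) σ := by
  obtain ⟨A, hA0, hA⟩ := exists_antideriv_Ici ha
  have hAc : ContinuousOn A (Ici 0) := fun σ hσ => (hA σ hσ).continuousAt.continuousWithinAt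
  obtain ⟨B, hB0, hB⟩ := exists_antideriv_Ici
    (a := fun σ => Real.exp (A σ) * (a σ * e σ)) (by fun_prop)
  refine ⟨fun σ => Real.exp (-A σ) * (w₀ + B σ), by simp [hA0, hB0], fun σ hσ => ?_⟩
  have h := ((hA σ hσ).neg.exp.mul ((hB σ hσ).const_add w₀)).hasDerivWithinAt (s := Ici 0)
  refine h.congr_deriv ?_
  have : Real.exp (-A σ) * Real.exp (A σ) = 1 := by rw [← Real.exp_add]; simp
  simp only [Pi.neg_apply]
  linear_combination (a σ * e σ) * this

/-- Multiplication by the integrating factor `exp A`, where `A' = a`. -/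
lemma hasDerivWithinAt_mul_exp {z z' a A : ℝ → ℝ} {s : Set ℝ} {σ : ℝ}
    (hz : HasDerivWithinAt z (z' σ) s σ) (hA : HasDerivAt A (a σ) σ) :
    HasDerivWithinAt (fun σ => z σ * Real.exp (A σ)) ((z' σ + a σ * z σ) * Real.exp (A σ)) s σ :=
  (hz.mul hA.hasDerivWithinAt.exp).congr_deriv (by ring)

/-- A solution of `w' = a (e - w)` with `a ≥ 0` stays above every lower bound of `w 0` and `e`. -/
lemma linear_solution_ge {a e w : ℝ → ℝ} {l : ℝ} (ha : ContinuousOn a (Ici 0))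
    (ha0 : ∀ σ ∈ Ici (0 : ℝ), 0 ≤ a σ) (he : ∀ σ ∈ Ici (0 : ℝ), l ≤ e σ) (h0 : l ≤ w 0)
    (hw : ∀ σ ∈ Ici (0 : ℝ), HasDerivWithinAt w (a σ * (e σ - w σ)) (Ici 0) σ) :
    ∀ σ ∈ Ici (0 : ℝ), l ≤ w σ := by
  obtain ⟨A, hA0, hA⟩ := exists_antideriv_Ici ha
  have hm : MonotoneOn (fun σ => (w σ - l) * Real.exp (A σ)) (Ici 0) := by
    refine monotoneOn_Ici_of_hasDerivWithinAt_nonneg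
      (fun σ hσ => hasDerivWithinAt_mul_exp
        (z' := fun σ => a σ * (e σ - w σ)) ((hw σ hσ).sub_const l) (hA σ hσ)) ?_
    intro σ hσ
    have h1 := ha0 σ hσ
    have h2 := he σ hσ
    have : a σ * (e σ - w σ) + a σ * (w σ - l) = a σ * (e σ - l) := by ring
    rw [this]
    exact mul_nonneg (mul_nonneg h1 (by linarith)) (Real.exp_pos _).le
  intro σ hσ
  have h := hm self_mem_Ici hσ hσ
  simp only [hA0, Real.exp_zero, mul_one] at h
  have h3 : 0 ≤ (w σ - l) * Real.exp (A σ) := by linarith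
  have := nonneg_of_mul_nonneg_left h3 (Real.exp_pos _)
  linarith

lemma linear_solution_le {a e w : ℝ → ℝ} {l : ℝ} (ha : ContinuousOn a (Ici 0))
    (ha0 : ∀ σ ∈ Ici (0 : ℝ), 0 ≤ a σ) (he : ∀ σ ∈ Ici (0 : ℝ), e σ ≤ l) (h0 : w 0 ≤ l)
    (hw : ∀ σ ∈ Ici (0 : ℝ), HasDerivWithinAt w (a σ * (e σ - w σ)) (Ici 0) σ) :
    ∀ σ ∈ Ici (0 : ℝ), w σ ≤ l := by
  intro σ hσ
  have := linear_solution_ge (e := fun σ => -e σ) (w := fun σ => -w σ) (l := -l) ha ha0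
    (fun σ hσ => neg_le_neg (he σ hσ)) (neg_le_neg h0)
    (fun σ hσ => (hw σ hσ).neg.congr_deriv (by ring)) σ hσ
  linarith

/-- If `a` is bounded below by a positive constant and `e → l`, then no solution of
`w' = a (e - w)` stays away from `l` from below. -/
lemma linear_solution_eventually_ge {a e w : ℝ → ℝ} {l a₀ ε : ℝ} (ha : ContinuousOn a (Ici 0))
    (ha0 : 0 < a₀) (haa : ∀ σ ∈ Ici (0 : ℝ), a₀ ≤ a σ) (he : Tendsto e atTop (𝓝 l))
    (hw : ∀ σ ∈ Ici (0 : ℝ), HasDerivWithinAt w (a σ * (e σ - w σ)) (Ici 0) σ) (hε : 0 < ε) :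
    ∀ᶠ σ in atTop, l - ε ≤ w σ := by
  obtain ⟨A, hA0, hA⟩ := exists_antideriv_Ici ha
  have hAm : MonotoneOn (fun σ => A σ - a₀ * σ) (Ici 0) :=
    monotoneOn_Ici_of_hasDerivWithinAt_nonneg (f' := fun σ => a σ - a₀)
      (fun σ hσ => (((hA σ hσ).sub ((hasDerivAt_id σ).const_mul a₀)).hasDerivWithinAt).congr_deriv
        (by simp)) fun σ hσ => sub_nonneg.2 (haa σ hσ)
  have hAge : ∀ σ ∈ Ici (0 : ℝ), a₀ * σ ≤ A σ := by
    intro σ hσ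
    have := hAm self_mem_Ici hσ hσ
    simp only [hA0, mul_zero, sub_zero] at this
    linarith
  have hAtop : Tendsto A atTop atTop :=
    tendsto_atTop_mono' _ ((eventually_ge_atTop 0).mono fun σ hσ => hAge σ hσ)
      (tendsto_id.const_mul_atTop ha0)
  obtain ⟨N, hN0, hN⟩ : ∃ N ≥ (0 : ℝ), ∀ σ ≥ N, l - ε / 2 ≤ e σ := by
    have := he.eventually (eventually_ge_nhds (show l - ε / 2 < l by linarith))
    obtain ⟨N, hN⟩ := eventually_atTop.1 this
    exact ⟨max N 0, le_max_right _ _, fun σ hσ => hN σ (le_trans (le_max_left _ _) hσ)⟩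
  have hm : MonotoneOn (fun σ => (w σ - (l - ε / 2)) * Real.exp (A σ)) (Ici N) := by
    refine monotoneOn_Ici_of_hasDerivWithinAt_nonneg
      (fun σ hσ => hasDerivWithinAt_mul_exp (z' := fun σ => a σ * (e σ - w σ))
        (((hw σ (hN0.trans hσ)).mono (Ici_subset_Ici.2 hN0)).sub_const (l - ε / 2))
        (hA σ (hN0.trans hσ))) ?_
    intro σ hσ
    have h1 := ha0.le.trans (haa σ (hN0.trans hσ))
    have h2 := hN σ hσ
    have : a σ * (e σ - w σ) + a σ * (w σ - (l - ε / 2)) = a σ * (e σ - (l - ε / 2)) := by ring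
    rw [this]
    exact mul_nonneg (mul_nonneg h1 (by linarith)) (Real.exp_pos _).le
  set C := (w N - (l - ε / 2)) * Real.exp (A N)
  have hlim : Tendsto (fun σ => C * Real.exp (-A σ)) atTop (𝓝 0) := by
    simpa using (Real.tendsto_exp_neg_atTop_nhds_zero.comp hAtop).const_mul C
  filter_upwards [hlim.eventually (eventually_ge_nhds (show -(ε / 2) < 0 by linarith)),
    eventually_ge_atTop N] with σ h1 h2
  have h3 : C ≤ (w σ - (l - ε / 2)) * Real.exp (A σ) := hm self_mem_Ici h2 h2
  have h4 := mul_le_mul_of_nonneg_right h3 (Real.exp_pos (-A σ)).le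
  rw [mul_assoc _ (Real.exp (A σ)), ← Real.exp_add, add_neg_cancel, Real.exp_zero, mul_one] at h4
  linarith

lemma linear_solution_tendsto {a e w : ℝ → ℝ} {l a₀ : ℝ} (ha : ContinuousOn a (Ici 0))
    (ha0 : 0 < a₀) (haa : ∀ σ ∈ Ici (0 : ℝ), a₀ ≤ a σ) (he : Tendsto e atTop (𝓝 l))
    (hw : ∀ σ ∈ Ici (0 : ℝ), HasDerivWithinAt w (a σ * (e σ - w σ)) (Ici 0) σ) :
    Tendsto w atTop (𝓝 l) := by
  rw [Metric.tendsto_nhds]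
  intro ε hε
  filter_upwards [linear_solution_eventually_ge ha ha0 haa he hw (half_pos hε),
    linear_solution_eventually_ge (e := fun σ => -e σ) (w := fun σ => -w σ) ha ha0 haa he.neg
    (fun σ hσ => (hw σ hσ).neg.congr_deriv (by ring)) (half_pos hε)] with σ h1 h2
  rw [Real.dist_eq, abs_lt]
  constructor <;> linarith

/-- Solutions of `y' = -a y`. -/
lemma homogeneous_solution_eq {a A y : ℝ → ℝ} (hA0 : A 0 = 0)
    (hA : ∀ σ ∈ Ici (0 : ℝ), HasDerivAt A (a σ) σ)
    (hy : ∀ σ ∈ Ici (0 : ℝ), HasDerivWithinAt y (-(a σ * y σ)) (Ici 0) σ) :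
    ∀ σ ∈ Ici (0 : ℝ), y σ = y 0 * Real.exp (-A σ) := by
  have hd : ∀ σ ∈ Ici (0 : ℝ), HasDerivWithinAt (fun σ => y σ * Real.exp (A σ)) 0 (Ici 0) σ :=
    fun σ hσ => (hasDerivWithinAt_mul_exp (z' := fun σ => -(a σ * y σ)) (hy σ hσ)
      (hA σ hσ)).congr_deriv (by ring)
  have h1 := monotoneOn_Ici_of_hasDerivWithinAt_nonneg (f' := fun _ => 0) hd (fun _ _ => le_rfl)
  have h2 := monotoneOn_Ici_of_hasDerivWithinAt_nonneg (f' := fun _ => 0)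
    (fun σ hσ => (hd σ hσ).neg.congr_deriv neg_zero) (fun _ _ => le_rfl)
  intro σ hσ
  have h3 := h1 self_mem_Ici hσ hσ
  have h4 := h2 self_mem_Ici hσ hσ
  simp only [Pi.neg_apply, hA0, Real.exp_zero, mul_one] at h3 h4
  have h5 : y 0 = y σ * Real.exp (A σ) := by linarith
  rw [h5, mul_assoc, ← Real.exp_add, add_neg_cancel, Real.exp_zero, mul_one]

/-! ### Change of time -/

/-- A change of time `s` with rate `r > 0` on `[0, ∞)`, together with its inverse `g`. -/
lemma exists_time_change {r : ℝ → ℝ} (hr : ContinuousOn r (Ici 0))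
    (hpos : ∀ σ ∈ Ici (0 : ℝ), 0 < r σ) :
    ∃ s g : ℝ → ℝ, s 0 = 0 ∧ Continuous s ∧ StrictMono s ∧ (∀ σ, g (s σ) = σ) ∧
      ∀ σ ∈ Ici (0 : ℝ), HasDerivAt s (r σ) σ ∧ HasDerivAt g (r σ)⁻¹ (s σ) := by
  -- extending `r` by the constant `r 0` to negative times makes `s` a bijection onto an open set
  have hc : Continuous fun σ => r (max σ 0) :=
    hr.comp_continuous (by fun_prop) fun σ => le_max_right σ 0
  have hp : ∀ σ, 0 < r (max σ 0) := fun σ => hpos _ (le_max_right σ 0)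
  have hs := fun σ => hc.integral_hasStrictDerivAt 0 σ
  set s : ℝ → ℝ := fun σ => ∫ ρ in (0 : ℝ)..σ, r (max ρ 0) with hsdef
  have hmono : StrictMono s := strictMono_of_hasDerivAt_pos (fun σ => (hs σ).hasDerivAt) hp
  have hg : ∀ σ, Function.invFun s (s σ) = σ := Function.leftInverse_invFun hmono.injective
  refine ⟨s, Function.invFun s, by simp [hsdef],
    continuous_iff_continuousAt.2 fun σ => (hs σ).hasDerivAt.continuousAt, hmono, hg,
    fun σ hσ => ?_⟩
  have h1 := hs σ
  have h2 := (hs σ).to_local_left_inverse (hp σ).ne' (Eventually.of_forall hg)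
  simp only [max_eq_left (mem_Ici.1 hσ)] at h1 h2
  exact ⟨h1.hasDerivAt, h2.hasDerivAt⟩

/-- Changing the time of a solution `Y` multiplies its velocity by the inverse rate. -/
lemma hasDerivWithinAt_time_change {s g r : ℝ → ℝ} {Y : ℝ → ℝ × ℝ} {v : ℝ × ℝ} {σ : ℝ}
    (hgs : ∀ σ, g (s σ) = σ) (hg : HasDerivAt g (r σ)⁻¹ (s σ))
    (hY : HasDerivWithinAt Y v (Ici 0) σ) :
    HasDerivWithinAt (Y ∘ g) ((r σ)⁻¹ • v) (s '' Ici 0) (s σ) := by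
  have hmaps : MapsTo g (s '' Ici 0) (Ici 0) := by
    rintro _ ⟨ρ, hρ, rfl⟩
    rwa [hgs]
  refine HasDerivWithinAt.scomp (s σ) (t' := Ici 0) ?_ hg.hasDerivWithinAt hmaps
  rwa [hgs]

lemma surj_of_tendsto_atTop {s : ℝ → ℝ} (h0 : s 0 = 0) (hc : Continuous s)
    (hs : Tendsto s atTop atTop) : Ici 0 ⊆ s '' Ici 0 := by
  intro t ht
  obtain ⟨N, hN, hN0⟩ := ((hs.eventually_ge_atTop t).and (eventually_ge_atTop 0)).exists
  obtain ⟨σ, hσ, rfl⟩ := intermediate_value_Icc hN0 hc.continuousOn ⟨h0.trans_le ht, hN⟩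
  exact ⟨σ, hσ.1, rfl⟩

lemma tendsto_inverse_atTop {s g : ℝ → ℝ} (h0 : s 0 = 0) (hc : Continuous s)
    (hmono : StrictMono s) (hgs : ∀ σ, g (s σ) = σ) (hs : Tendsto s atTop atTop) :
    Tendsto g atTop atTop := by
  refine tendsto_atTop.2 fun N => ?_
  filter_upwards [eventually_ge_atTop 0, eventually_ge_atTop (s N)] with t ht0 htN
  obtain ⟨σ, -, rfl⟩ := surj_of_tendsto_atTop h0 hc hs ht0
  rw [hgs]
  exact hmono.le_iff_le.1 htN

lemma lt_of_tendsto_strictMono {s : ℝ → ℝ} {S : ℝ} (hmono : StrictMono s)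
    (hs : Tendsto s atTop (𝓝 S)) (σ : ℝ) : s σ < S :=
  (hmono (lt_add_one σ)).trans_le (hmono.monotone.ge_of_tendsto hs _)

lemma surj_of_tendsto_nhds {s : ℝ → ℝ} {S : ℝ} (h0 : s 0 = 0) (hc : Continuous s)
    (hs : Tendsto s atTop (𝓝 S)) : Ico 0 S ⊆ s '' Ici 0 := by
  intro t ht
  obtain ⟨N, hN, hN0⟩ := ((hs.eventually (eventually_ge_nhds ht.2)).and
    (eventually_ge_atTop 0)).exists
  obtain ⟨σ, hσ, rfl⟩ := intermediate_value_Icc hN0 hc.continuousOn ⟨h0.trans_le ht.1, hN⟩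
  exact ⟨σ, hσ.1, rfl⟩

lemma tendsto_inverse_nhdsLT {s g : ℝ → ℝ} {S : ℝ} (h0 : s 0 = 0) (hc : Continuous s)
    (hmono : StrictMono s) (hgs : ∀ σ, g (s σ) = σ) (hs : Tendsto s atTop (𝓝 S)) :
    Tendsto g (𝓝[<] S) atTop := by
  refine tendsto_atTop.2 fun N => ?_
  have hS0 : 0 < S := h0 ▸ lt_of_tendsto_strictMono hmono hs 0
  filter_upwards [Ioo_mem_nhdsLT (max_lt hS0 (lt_of_tendsto_strictMono hmono hs N))] with t ht
  obtain ⟨σ, -, rfl⟩ := surj_of_tendsto_nhds h0 hc hs ⟨(le_max_left _ _).trans ht.1.le, ht.2⟩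
  rw [hgs]
  exact hmono.le_iff_le.1 ((le_max_right _ _).trans ht.1.le)

/-! ### Smooth solution of a scalar equation with a regular singular point -/

lemma mul_mem_Icc_of_mem {ρ x t : ℝ} (hx : x ∈ Icc (-ρ) ρ) (ht : t ∈ uIcc (0 : ℝ) 1) :
    t * x ∈ Icc (-ρ) ρ := by
  rw [uIcc_of_le zero_le_one] at ht
  rw [mem_Icc, ← abs_le] at hx ⊢
  rw [abs_mul, abs_of_nonneg ht.1]
  exact (mul_le_of_le_one_left (abs_nonneg x) ht.2).trans hx

lemma intervalIntegrable_mul_comp {wt h : ℝ → ℝ} {r x : ℝ}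
    (hw : IntervalIntegrable wt MeasureTheory.volume 0 1) (hh : ContinuousOn h (Ioo (-r) r))
    (hx : x ∈ Ioo (-r) r) :
    IntervalIntegrable (fun t => wt t * h (t * x)) MeasureTheory.volume 0 1 := by
  obtain ⟨ρ, hxρ, hρr⟩ := exists_between (abs_lt.2 hx)
  refine hw.mul_continuousOn (hh.comp (by fun_prop) fun t ht => ?_)
  exact (Icc_subset_Ioo (by linarith) hρr) (mul_mem_Icc_of_mem (abs_le.1 hxρ.le) ht)

/-- Differentiation under the integral sign for `x ↦ ∫₀¹ wt(t) h(tx) dt`. -/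
lemma hasDerivAt_integral_mul_comp {wt h : ℝ → ℝ} {r x : ℝ}
    (hw : IntervalIntegrable wt MeasureTheory.volume 0 1) (hh : ContDiffOn ℝ 1 h (Ioo (-r) r))
    (hx : x ∈ Ioo (-r) r) :
    HasDerivAt (fun x => ∫ t in (0 : ℝ)..1, wt t * h (t * x))
      (∫ t in (0 : ℝ)..1, wt t * t * deriv h (t * x)) x := by
  obtain ⟨ρ, hxρ, hρr⟩ := exists_between (abs_lt.2 hx)
  have hd : ContinuousOn (deriv h) (Ioo (-r) r) := hh.continuousOn_deriv_of_isOpen isOpen_Ioo le_rfl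
  have hsub : Icc (-ρ) ρ ⊆ Ioo (-r) r := Icc_subset_Ioo (by linarith) hρr
  obtain ⟨C, hC⟩ := isCompact_Icc.exists_bound_of_continuousOn (hd.mono hsub)
  have hwt : IntervalIntegrable (fun t => wt t * t) MeasureTheory.volume 0 1 :=
    hw.mul_continuousOn continuous_id.continuousOn
  have hnear : Ioo (-ρ) ρ ∈ 𝓝 x := Ioo_mem_nhds (abs_lt.1 hxρ).1 (abs_lt.1 hxρ).2
  refine (intervalIntegral.hasDerivAt_integral_of_dominated_loc_of_deriv_le
    (F := fun x t => wt t * h (t * x)) (F' := fun x t => wt t * t * deriv h (t * x))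
    (bound := fun t => ‖wt t * t‖ * C) hnear ?_
    (intervalIntegrable_mul_comp hw hh.continuousOn hx) ?_ ?_ (hwt.norm.mul_const C) ?_).2
  · filter_upwards [hnear] with y hy
    exact (intervalIntegrable_iff.1 (intervalIntegrable_mul_comp hw hh.continuousOn
      (hsub (Ioo_subset_Icc_self hy)))).aestronglyMeasurable
  · exact (intervalIntegrable_iff.1 (intervalIntegrable_mul_comp hwt hd hx)).aestronglyMeasurable
  · refine Eventually.of_forall fun t ht y hy => ?_
    rw [norm_mul]
    exact mul_le_mul_of_nonneg_left
      (hC _ (mul_mem_Icc_of_mem (Ioo_subset_Icc_self hy) (uIoc_subset_uIcc ht))) (norm_nonneg _)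
  · refine Eventually.of_forall fun t ht y hy => ?_
    have hm := hsub (mul_mem_Icc_of_mem (Ioo_subset_Icc_self hy) (uIoc_subset_uIcc ht))
    have h1 : HasDerivAt h (deriv h (t * y)) (t * y) :=
      ((hh.differentiableOn (by norm_num)).differentiableAt
        (isOpen_Ioo.mem_nhds hm)).hasDerivAt
    have h2 : HasDerivAt (fun y : ℝ => t * y) t y := by simpa using (hasDerivAt_id y).const_mul t
    exact ((h1.comp y h2).const_mul (wt t)).congr_deriv (by ring)

lemma contDiffOn_integral_mul_comp {r : ℝ} (n : ℕ) {wt h : ℝ → ℝ}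
    (hw : IntervalIntegrable wt MeasureTheory.volume 0 1)
    (hh : ContDiffOn ℝ ∞ h (Ioo (-r) r)) :
    ContDiffOn ℝ n (fun x => ∫ t in (0 : ℝ)..1, wt t * h (t * x)) (Ioo (-r) r) := by
  have hd1 : ∀ {wt h : ℝ → ℝ}, IntervalIntegrable wt MeasureTheory.volume 0 1 →
      ContDiffOn ℝ ∞ h (Ioo (-r) r) → DifferentiableOn ℝ
        (fun x => ∫ t in (0 : ℝ)..1, wt t * h (t * x)) (Ioo (-r) r) := fun hw hh x hx =>
    (hasDerivAt_integral_mul_comp hw (hh.of_le (by exact_mod_cast le_top))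
      hx).differentiableAt.differentiableWithinAt
  induction n generalizing wt h with
  | zero => exact contDiffOn_zero.2 (hd1 hw hh).continuousOn
  | succ n ih =>
    push_cast
    refine (contDiffOn_succ_iff_deriv_of_isOpen isOpen_Ioo).2 ⟨hd1 hw hh, by simp, ?_⟩
    refine (ih (hw.mul_continuousOn continuous_id.continuousOn)
      ((contDiffOn_infty_iff_deriv_of_isOpen isOpen_Ioo).1 hh).2).congr fun x hx => ?_
    exact (hasDerivAt_integral_mul_comp hw (hh.of_le (by exact_mod_cast le_top)) hx).deriv

/-- For `ξ < 1` the equation `x J' + (1 - ξ) J = h`, singular at `0`, has the smooth solution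
`J(x) = ∫₀¹ t^(-ξ) h(tx) dt`. -/
lemma exists_smooth_solution_singular {ξ r : ℝ} (hξ : ξ < 1) {h : ℝ → ℝ}
    (hh : ContDiffOn ℝ ∞ h (Ioo (-r) r)) :
    ∃ J : ℝ → ℝ, ContDiffOn ℝ ∞ J (Ioo (-r) r) ∧
      ∀ x ∈ Ioo (-r) r, x * deriv J x + (1 - ξ) * J x = h x := by
  have hw : IntervalIntegrable (fun t : ℝ => t ^ (-ξ)) MeasureTheory.volume 0 1 :=
    intervalIntegral.intervalIntegrable_rpow' (by linarith)
  refine ⟨fun x => ∫ t in (0 : ℝ)..1, t ^ (-ξ) * h (t * x),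
    contDiffOn_infty.2 fun n => contDiffOn_integral_mul_comp n hw hh, fun x hx => ?_⟩
  have hh1 : ContDiffOn ℝ 1 h (Ioo (-r) r) := hh.of_le (by exact_mod_cast le_top)
  have hdc : ContinuousOn (deriv h) (Ioo (-r) r) :=
    hh1.continuousOn_deriv_of_isOpen isOpen_Ioo le_rfl
  rw [(hasDerivAt_integral_mul_comp hw hh1 hx).deriv]
  have hi1 := intervalIntegrable_mul_comp hw hh.continuousOn hx
  have hi2 := intervalIntegrable_mul_comp
    (hw.mul_continuousOn (g := fun t : ℝ => t) continuous_id.continuousOn) hdc hx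
  rw [← intervalIntegral.integral_const_mul, ← intervalIntegral.integral_const_mul,
    ← intervalIntegral.integral_add (hi2.const_mul x) (hi1.const_mul (1 - ξ))]
  obtain ⟨ρ, hxρ, hρr⟩ := exists_between (abs_lt.2 hx)
  have hmem : ∀ t ∈ Icc (0 : ℝ) 1, t * x ∈ Ioo (-r) r := fun t ht =>
    (Icc_subset_Ioo (by linarith) hρr)
      (mul_mem_Icc_of_mem (abs_le.1 hxρ.le) (by rwa [uIcc_of_le zero_le_one]))
  -- the integrand is the derivative of `t ^ (1 - ξ) * h (t * x)`
  have key := intervalIntegral.integral_eq_sub_of_hasDerivAt_of_le (zero_le_one' ℝ)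
    (f := fun t => t ^ (1 - ξ) * h (t * x))
    (f' := fun t => x * (t ^ (-ξ) * t * deriv h (t * x)) + (1 - ξ) * (t ^ (-ξ) * h (t * x)))
    ?_ ?_ ((hi2.const_mul x).add (hi1.const_mul (1 - ξ)))
  · rw [key]
    simp [Real.zero_rpow (show 1 - ξ ≠ 0 by linarith)]
  · refine ContinuousOn.mul (fun t _ => ?_) (hh.continuousOn.comp (by fun_prop) hmem)
    exact (Real.continuousAt_rpow_const _ _ (Or.inr (by linarith))).continuousWithinAt
  · intro t ht
    have h1 : HasDerivAt h (deriv h (t * x)) (t * x) :=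
      ((hh1.differentiableOn (by norm_num)).differentiableAt
        (isOpen_Ioo.mem_nhds (hmem t (Ioo_subset_Icc_self ht)))).hasDerivAt
    have h2 : HasDerivAt (fun t : ℝ => t * x) x t := by
      simpa using (hasDerivAt_id t).mul_const x
    have h3 := Real.hasDerivAt_rpow_const (x := t) (p := 1 - ξ) (Or.inl ht.1.ne')
    refine (h3.mul (h1.comp t h2)).congr_deriv ?_
    rw [show 1 - ξ - 1 = -ξ by ring]
    have h4 : t ^ (1 - ξ) = t ^ (-ξ) * t := by
      rw [show 1 - ξ = -ξ + 1 by ring, Real.rpow_add_one ht.1.ne']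
    rw [h4]
    simp only [Function.comp]
    ring

/-! ### The invariant curve `φ² = M(θ)` -/

lemma relaxRate_eq {α μ θ : ℝ} (hα : 0 < α) (hμ : muP α < μ) (hθ : Real.cos θ ≠ 0) :
    relaxRate α μ θ = 2 * Real.tan θ * (1 - pPlus α μ θ) := by
  have h1 := slope_mul hα hμ
  have h2 := two_mul_slope α μ
  have h3 := Real.sin_sq_add_cos_sq θ
  have h4 := Real.tan_mul_cos hθ
  rw [pPlus_eq hα hμ hθ]
  unfold relaxRate cPlus
  rw [← h4] at h3 ⊢
  generalize Real.cos θ = c at *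
  generalize Real.tan θ = t at *
  generalize slope α μ = u at *
  generalize gap α μ = D at *
  linear_combination (2 * t) * h3 + (2 * t * c ^ 2) * h1 - (2 * t ^ 2 * c ^ 2) * h2

/-- In the slope variable `x = tan θ - tan θ₁` the equation of the orbits for `φ² - 1 / sin θ` has
a regular singular point at `x = 0`, with exponent `ξ`; for `ξ < 1` it has a smooth solution. -/
lemma exists_smooth_solution_slope {α μ : ℝ} (hα : 0 < α) (hμ : muP α < μ) (hξ : xi α μ < 1) :
    ∃ Z : ℝ → ℝ, ∃ r > 0, ContDiffOn ℝ ∞ Z (Ioo (-r) r) ∧ Z 0 = 0 ∧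
      ∀ x ∈ Ioo (-r) r, (x - gap α μ) * (x * deriv Z x) =
        x * (x - gap α μ) * Real.cos (Real.arctan (slope α μ + x)) / (slope α μ + x) ^ 2 -
        2 * (slope α μ + x) *
          (1 - x * (x - gap α μ) / (1 + (slope α μ + x) ^ 2)) * Z x := by
  have hξu : xi α μ * gap α μ = 2 * slope α μ := by
    rw [xi_eq hα hμ, div_mul_cancel₀ _ (gap_pos hα hμ).ne']
  have hu := slope_pos hα hμ
  have hD := gap_pos hα hμ
  generalize xi α μ = ξ at *
  generalize slope α μ = u at *
  generalize gap α μ = D at *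
  set r := min u D with hr
  have hr0 : 0 < r := lt_min hu hD
  have hxD : ∀ x ∈ Ioo (-r) r, 0 < D - x := fun x hx => by
    have := hx.2.trans_le (min_le_right u D); linarith
  have hxu : ∀ x ∈ Ioo (-r) r, 0 < u + x := fun x hx => by
    have h1 := hx.1
    have := min_le_left u D
    linarith
  -- an integrating factor, up to the singular factor `|x| ^ (-ξ)`
  set E : ℝ → ℝ := fun x => (D - x) ^ (ξ + 2) / (1 + (u + x) ^ 2) with hE
  set k : ℝ → ℝ := fun x => Real.cos (Real.arctan (u + x)) / (u + x) ^ 2 with hk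
  have hE0 : ∀ x ∈ Ioo (-r) r, E x ≠ 0 := fun x hx =>
    (div_pos (Real.rpow_pos_of_pos (hxD x hx) _) (by positivity)).ne'
  have hEs : ContDiffOn ℝ ∞ E (Ioo (-r) r) := by
    refine ContDiffOn.div (ContDiffOn.rpow_const_of_ne (by fun_prop)
      fun x hx => (hxD x hx).ne') (by fun_prop) fun x _ => by positivity
  have hks : ContDiffOn ℝ ∞ k (Ioo (-r) r) := by
    refine ContDiffOn.div ?_ (by fun_prop) fun x hx => (pow_pos (hxu x hx) 2).ne'
    exact (Real.contDiff_cos.comp (Real.contDiff_arctan.comp (by fun_prop))).contDiffOn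
  obtain ⟨J, hJ, hJe⟩ := exists_smooth_solution_singular hξ (hEs.mul hks)
  refine ⟨fun x => x * J x / E x, r, hr0, (contDiffOn_id.mul hJ).div hEs hE0, by simp, ?_⟩
  intro x hx
  have hJd : HasDerivAt J (deriv J x) x := ((hJ.differentiableOn (by simp)).differentiableAt
    (isOpen_Ioo.mem_nhds hx)).hasDerivAt
  have hEd : HasDerivAt E (-E x * ((ξ + 2) / (D - x) + 2 * (u + x) / (1 + (u + x) ^ 2))) x := by
    have h1 : HasDerivAt (fun x : ℝ => D - x) (-1) x := by
      simpa using (hasDerivAt_id x).const_sub D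
    have h2 := h1.rpow_const (p := ξ + 2) (Or.inl (hxD x hx).ne')
    have h3 : HasDerivAt (fun x : ℝ => 1 + (u + x) ^ 2) (2 * (u + x)) x := by
      simpa using (((hasDerivAt_id x).const_add u).pow 2).const_add 1
    have h4 : (1 + (u + x) ^ 2) ≠ 0 := by positivity
    refine (h2.div h3 h4).congr_deriv ?_
    have h5 : (D - x) ^ (ξ + 2 - 1) = (D - x) ^ (ξ + 2) / (D - x) :=
      Real.rpow_sub_one (hxD x hx).ne' _
    rw [h5]
    have := (hxD x hx).ne'
    simp only [hE]
    field_simp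
    ring
  have hZd := ((hasDerivAt_id x).mul hJd).div hEd (hE0 x hx)
  have hZd' : deriv (fun x => x * J x / E x) x = _ := hZd.deriv
  rw [hZd']
  have h1 := hJe x hx
  simp only [hk] at h1
  have h2 := (hxD x hx).ne'
  have h3 := (hxu x hx).ne'
  have h4 := hE0 x hx
  have h5 : (1 + (u + x) ^ 2) ≠ 0 := by positivity
  simp only [Pi.mul_apply, id]
  generalize E x = e at *
  generalize Real.cos (Real.arctan (u + x)) = q at *
  generalize deriv J x = j' at *
  generalize J x = j at *
  have h6 : x * j' = e * (q / (u + x) ^ 2) - (1 - ξ) * j := by linear_combination h1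
  have h7 : x * (((1 * j + x * j') * e - x * j * (-e * ((ξ + 2) / (D - x) +
      2 * (u + x) / (1 + (u + x) ^ 2)))) / e ^ 2) =
      x * (j + (e * (q / (u + x) ^ 2) - (1 - ξ) * j)) / e + x * (x * j / e) * ((ξ + 2) / (D - x) +
      2 * (u + x) / (1 + (u + x) ^ 2)) := by
    rw [← h6]; field_simp; ring
  rw [h7]
  have h8 : ξ * D = 2 * u := hξu
  have h9 : (x - D) * ((ξ + 2) / (D - x)) = -(ξ + 2) := by
    rw [← neg_sub D x]; field_simp
  have h10 : x * (j + (e * (q / (u + x) ^ 2) - (1 - ξ) * j)) / e =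
      x * q / (u + x) ^ 2 + ξ * (x * j / e) := by field_simp; ring
  rw [h10]
  generalize x * j / e = z at *
  linear_combination (x * z) * h9 - z * h8

/-- For `ξ < 1` there is a smooth curve `φ² = M(θ)` through `P` which is invariant under the flow:
along orbits `φ²` satisfies the linear equation `p₊ (φ²)' = 2 c₊ sin θ (1 / sin θ - φ²)`. -/
theorem exists_invariant_curve {α μ : ℝ} (hα : 0 < α) (hμ : muP α < μ) (hξ : xi α μ < 1) :
    ∃ M : ℝ → ℝ, ∃ r > 0, ContDiffOn ℝ ∞ M (Ioo (theta1 α μ - r) (theta1 α μ + r)) ∧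
      M (theta1 α μ) = 1 / Real.sin (theta1 α μ) ∧
      ∀ θ ∈ Ioo (theta1 α μ - r) (theta1 α μ + r),
        pPlus α μ θ * deriv M θ = relaxRate α μ θ * (1 / Real.sin θ - M θ) := by
  obtain ⟨Z, ρ, hρ, hZ, hZ0, hZe⟩ := exists_smooth_solution_slope hα hμ hξ
  have hcont : ContinuousAt (fun θ => Real.tan θ - slope α μ) (theta1 α μ) :=
    (Real.continuousAt_tan.2 (cos_theta1_pos α μ).ne').sub continuousAt_const
  have hev : ∀ᶠ θ in 𝓝 (theta1 α μ), Real.tan θ - slope α μ ∈ Ioo (-ρ) ρ ∧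
      θ ∈ Ioo 0 (Real.pi / 2) := by
    refine (hcont.eventually_mem (Ioo_mem_nhds ?_ ?_)).and
      (Ioo_mem_nhds (theta1_pos hα hμ) (theta1_lt α μ)) <;> simp [tan_theta1, hρ]
  obtain ⟨r, hr, hball⟩ := Metric.eventually_nhds_iff_ball.1 hev
  rw [Real.ball_eq_Ioo] at hball
  have hsin : ∀ θ ∈ Ioo (theta1 α μ - r) (theta1 α μ + r), 0 < Real.sin θ := fun θ hθ =>
    Real.sin_pos_of_pos_of_lt_pi (hball θ hθ).2.1
      ((hball θ hθ).2.2.trans (by linarith [Real.pi_pos]))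
  have hcos : ∀ θ ∈ Ioo (theta1 α μ - r) (theta1 α μ + r), 0 < Real.cos θ := fun θ hθ =>
    Real.cos_pos_of_mem_Ioo ⟨by linarith [(hball θ hθ).2.1, Real.pi_pos], (hball θ hθ).2.2⟩
  refine ⟨fun θ => 1 / Real.sin θ + Z (Real.tan θ - slope α μ), r, hr, ?_, ?_, ?_⟩
  · refine ContDiffOn.add (contDiffOn_const.div Real.contDiff_sin.contDiffOn
      fun θ hθ => (hsin θ hθ).ne') (hZ.comp (ContDiffOn.sub (fun θ hθ => ?_) contDiffOn_const)
      fun θ hθ => (hball θ hθ).1)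
    exact (Real.contDiffAt_tan.2 (hcos θ hθ).ne').contDiffWithinAt
  · simp [tan_theta1, hZ0]
  · intro θ hθ
    have hs := (hsin θ hθ).ne'
    have hc := (hcos θ hθ).ne'
    have hZd : HasDerivAt Z (deriv Z (Real.tan θ - slope α μ)) (Real.tan θ - slope α μ) :=
      ((hZ.differentiableOn (by simp)).differentiableAt
        (isOpen_Ioo.mem_nhds (hball θ hθ).1)).hasDerivAt
    have h1 := ((Real.hasDerivAt_sin θ).inv hs)
    have h2 := hZd.comp θ ((Real.hasDerivAt_tan hc).sub_const (slope α μ))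
    have h3 : HasDerivAt (fun θ => 1 / Real.sin θ + Z (Real.tan θ - slope α μ))
        (-Real.cos θ / Real.sin θ ^ 2 +
          deriv Z (Real.tan θ - slope α μ) * (1 / Real.cos θ ^ 2)) θ := by
      refine (h1.add h2).congr_of_eventuallyEq (Eventually.of_forall fun y => ?_)
      simp
    rw [h3.deriv, relaxRate_eq hα hμ hc]
    have h4 := hZe _ (hball θ hθ).1
    have harc : Real.arctan (Real.tan θ) = θ :=
      Real.arctan_tan (by linarith [(hball θ hθ).2.1, Real.pi_pos]) (hball θ hθ).2.2
    have h5 : 1 + Real.tan θ ^ 2 = 1 / Real.cos θ ^ 2 := by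
      rw [← Real.inv_one_add_tan_sq hc]; simp
    rw [add_sub_cancel, harc, h5] at h4
    rw [pPlus_eq hα hμ hc]
    have h7 : Real.tan θ ≠ 0 := fun h => hs (by rw [← Real.tan_mul_cos hc, h, zero_mul])
    have h8 : Real.sin θ = Real.tan θ * Real.cos θ := (Real.tan_mul_cos hc).symm
    beta_reduce
    rw [h8]
    generalize deriv Z (Real.tan θ - slope α μ) = z' at *
    generalize Z (Real.tan θ - slope α μ) = z at *
    generalize Real.cos θ = c at *
    generalize Real.tan θ = t at *
    generalize gap α μ = D at *
    generalize slope α μ = u at *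
    field_simp at h4 ⊢
    linear_combination c * h4

/-! ### Orbits in a trapping rectangle -/

/-- The vector field in the time `σ` with `dσ/dτ = φ`: in this time the angle `θ` moves
autonomously and `φ²` satisfies a linear equation. -/
def angleField (α μ : ℝ) (x : ℝ × ℝ) : ℝ × ℝ :=
  (pPlus α μ x.1, -(cPlus α μ x.1 * b x.1 x.2) / x.2)

/-- The rectangle of half-widths `c` and `δ` around `P`. -/
def box (α μ c δ : ℝ) : Set (ℝ × ℝ) :=
  Icc (theta1 α μ - c) (theta1 α μ + c) ×ˢ Icc (phi1 α μ - δ) (phi1 α μ + δ)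

/-- Conditions under which the rectangle `box α μ c δ` is forward invariant and contained in the
basin of `P`: in it the slope `tan θ` is closer to `tan θ₁` than to the other zero of `p₊`, and
`1 / sin θ`, towards which `φ²` relaxes at a rate bounded below, takes only values that `φ²` takes
on the rectangle. -/
structure IsTrapping (α μ c δ : ℝ) : Prop where
  c_pos : 0 < c
  δ_pos : 0 < δ
  δ_lt : δ < phi1 α μ
  angle_pos : ∀ θ ∈ Icc (theta1 α μ - c) (theta1 α μ + c), 0 < θ
  angle_lt : ∀ θ ∈ Icc (theta1 α μ - c) (theta1 α μ + c), θ < Real.pi / 2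
  tan_near : ∀ θ ∈ Icc (theta1 α μ - c) (theta1 α μ + c),
    |Real.tan θ - slope α μ| ≤ gap α μ / 2
  rate_ge : ∀ θ ∈ Icc (theta1 α μ - c) (theta1 α μ + c), slope α μ ≤ relaxRate α μ θ
  target_ge : ∀ θ ∈ Icc (theta1 α μ - c) (theta1 α μ + c),
    (phi1 α μ - δ) ^ 2 ≤ 1 / Real.sin θ
  target_le : ∀ θ ∈ Icc (theta1 α μ - c) (theta1 α μ + c),
    1 / Real.sin θ ≤ (phi1 α μ + δ) ^ 2

namespace IsTrapping

variable {α μ c δ : ℝ}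

lemma cos_pos (H : IsTrapping α μ c δ) {θ : ℝ}
    (hθ : θ ∈ Icc (theta1 α μ - c) (theta1 α μ + c)) : 0 < Real.cos θ :=
  Real.cos_pos_of_mem_Ioo ⟨by linarith [H.angle_pos θ hθ, Real.pi_pos], H.angle_lt θ hθ⟩

lemma sin_pos (H : IsTrapping α μ c δ) {θ : ℝ}
    (hθ : θ ∈ Icc (theta1 α μ - c) (theta1 α μ + c)) : 0 < Real.sin θ :=
  Real.sin_pos_of_pos_of_lt_pi (H.angle_pos θ hθ) (by linarith [H.angle_lt θ hθ, Real.pi_pos])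

lemma snd_pos (H : IsTrapping α μ c δ) {x : ℝ × ℝ} (hx : x ∈ box α μ c δ) : 0 < x.2 :=
  (sub_pos.2 H.δ_lt).trans_le hx.2.1

lemma theta1_mem (H : IsTrapping α μ c δ) :
    theta1 α μ ∈ Icc (theta1 α μ - c) (theta1 α μ + c) := by
  constructor <;> linarith [H.c_pos]

lemma tan_lt_iff (H : IsTrapping α μ c δ) {θ : ℝ}
    (hθ : θ ∈ Icc (theta1 α μ - c) (theta1 α μ + c)) :
    Real.tan θ < slope α μ ↔ θ < theta1 α μ := by
  rw [← tan_theta1]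
  have hm := Real.strictMonoOn_tan
  exact hm.lt_iff_lt ⟨by linarith [H.angle_pos θ hθ, Real.pi_pos], H.angle_lt θ hθ⟩
    ⟨by linarith [H.angle_pos _ H.theta1_mem, Real.pi_pos], theta1_lt α μ⟩

lemma lt_tan_iff (H : IsTrapping α μ c δ) {θ : ℝ}
    (hθ : θ ∈ Icc (theta1 α μ - c) (theta1 α μ + c)) :
    slope α μ < Real.tan θ ↔ theta1 α μ < θ := by
  rw [← tan_theta1]
  have hm := Real.strictMonoOn_tan
  exact hm.lt_iff_lt ⟨by linarith [H.angle_pos _ H.theta1_mem, Real.pi_pos], theta1_lt α μ⟩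
    ⟨by linarith [H.angle_pos θ hθ, Real.pi_pos], H.angle_lt θ hθ⟩

lemma pPlus_pos_iff (H : IsTrapping α μ c δ) (hα : 0 < α) (hμ : muP α < μ) {θ : ℝ}
    (hθ : θ ∈ Icc (theta1 α μ - c) (theta1 α μ + c)) :
    0 < pPlus α μ θ ↔ θ < theta1 α μ := by
  have h1 := H.cos_pos hθ
  have h2 := (abs_le.1 (H.tan_near θ hθ)).2
  have h3 := gap_pos hα hμ
  rw [pPlus_eq hα hμ h1.ne', mul_pos_iff_of_pos_left (pow_pos h1 2), ← H.tan_lt_iff hθ,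
    mul_pos_iff]
  constructor
  · rintro (h | h) <;> linarith
  · intro h
    right
    constructor <;> linarith

lemma pPlus_neg_iff (H : IsTrapping α μ c δ) (hα : 0 < α) (hμ : muP α < μ) {θ : ℝ}
    (hθ : θ ∈ Icc (theta1 α μ - c) (theta1 α μ + c)) :
    pPlus α μ θ < 0 ↔ theta1 α μ < θ := by
  have h1 := H.cos_pos hθ
  have h2 := (abs_le.1 (H.tan_near θ hθ)).2
  have h3 := gap_pos hα hμ
  rw [pPlus_eq hα hμ h1.ne', ← H.lt_tan_iff hθ, mul_neg_iff]
  have h4 := pow_pos h1 2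
  constructor
  · rintro (⟨-, h⟩ | ⟨h, -⟩)
    · rcases mul_neg_iff.1 h with h | h <;> linarith
    · linarith
  · intro h
    exact Or.inl ⟨h4, mul_neg_iff.2 (Or.inl ⟨by linarith, by linarith⟩)⟩

end IsTrapping

/-- The explicit motion of the angle: `x = tan θ - tan θ₁` satisfies the logistic equation
`dx/dσ = x (x - gap)`. -/
lemma exists_angle_solution {α μ c δ θ₀ : ℝ} (hα : 0 < α) (hμ : muP α < μ)
    (H : IsTrapping α μ c δ) (hθ : θ₀ ∈ Icc (theta1 α μ - c) (theta1 α μ + c)) :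
    ∃ θ : ℝ → ℝ, θ 0 = θ₀ ∧ (∀ σ ∈ Ici (0 : ℝ), HasDerivAt θ (pPlus α μ (θ σ)) σ) ∧
      (∀ σ ∈ Ici (0 : ℝ), θ σ ∈ Icc (theta1 α μ - c) (theta1 α μ + c)) ∧
      (∀ σ ∈ Ici (0 : ℝ), |θ σ - theta1 α μ| ≤ gap α μ * Real.exp (-(gap α μ * σ))) ∧
      (θ₀ < theta1 α μ → ∀ σ ∈ Ici (0 : ℝ), θ σ < theta1 α μ) := by
  have hD := gap_pos hα hμ
  set D := gap α μ with hDdef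
  set u := slope α μ with hudef
  -- the solution is `x = x₀ q` with `q = D exp (-D σ) / N`
  set x₀ := Real.tan θ₀ - u with hx₀
  have hx₀D : |x₀| ≤ D / 2 := H.tan_near θ₀ hθ
  have hθ₀arc : θ₀ = Real.arctan (u + x₀) := by
    rw [hx₀, add_sub_cancel, Real.arctan_tan _ (H.angle_lt θ₀ hθ)]
    linarith [H.angle_pos θ₀ hθ, Real.pi_pos]
  set N : ℝ → ℝ := fun σ => D - x₀ * (1 - Real.exp (-(D * σ))) with hN
  have hexp : ∀ σ ∈ Ici (0 : ℝ), Real.exp (-(D * σ)) ≤ 1 := fun σ hσ =>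
    Real.exp_le_one_iff.2 (by nlinarith [mem_Ici.1 hσ])
  have hNge : ∀ σ ∈ Ici (0 : ℝ), D / 2 ≤ N σ := by
    intro σ hσ
    have h1 := hexp σ hσ
    have h2 := Real.exp_pos (-(D * σ))
    have h3 : |x₀ * (1 - Real.exp (-(D * σ)))| ≤ D / 2 := by
      rw [abs_mul, abs_of_nonneg (show 0 ≤ 1 - Real.exp (-(D * σ)) by linarith)]
      exact (mul_le_of_le_one_right (abs_nonneg _) (by linarith)).trans hx₀D
    have := (abs_le.1 h3).2
    simp only [hN]
    linarith
  set q : ℝ → ℝ := fun σ => D * Real.exp (-(D * σ)) / N σ with hq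
  have hqpos : ∀ σ ∈ Ici (0 : ℝ), 0 < q σ := fun σ hσ =>
    div_pos (mul_pos hD (Real.exp_pos _)) (by linarith [hNge σ hσ])
  have hqle : ∀ σ ∈ Ici (0 : ℝ), q σ ≤ 1 := by
    intro σ hσ
    rw [hq, div_le_one (by linarith [hNge σ hσ])]
    have h1 := hexp σ hσ
    have h2 := (abs_le.1 hx₀D).2
    simp only [hN]
    nlinarith
  have hqle2 : ∀ σ ∈ Ici (0 : ℝ), q σ ≤ 2 * Real.exp (-(D * σ)) := by
    intro σ hσ
    rw [hq, div_le_iff₀ (by linarith [hNge σ hσ])]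
    nlinarith [hNge σ hσ, Real.exp_pos (-(D * σ))]
  have hθ1 : theta1 α μ = Real.arctan u := rfl
  refine ⟨fun σ => Real.arctan (u + x₀ * q σ), ?_, ?_, ?_, ?_, ?_⟩
  · simp [hq, hN, hD.ne', ← hθ₀arc]
  · intro σ hσ
    have hN0 : N σ ≠ 0 := by linarith [hNge σ hσ]
    have he : HasDerivAt (fun σ => Real.exp (-(D * σ))) (-D * Real.exp (-(D * σ))) σ := by
      have := (((hasDerivAt_id σ).const_mul D).neg).exp
      refine this.congr_deriv ?_
      simp; ring
    have hNd : HasDerivAt N (-(D * x₀ * Real.exp (-(D * σ)))) σ :=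
      (((he.const_sub 1).const_mul x₀).const_sub D).congr_deriv (by ring)
    have hqd := ((he.const_mul D).div hNd hN0)
    have hd := ((hqd.const_mul x₀).const_add u).arctan
    refine hd.congr_deriv ?_
    have hc : Real.cos (Real.arctan (u + x₀ * q σ)) ≠ 0 := (Real.cos_arctan_pos _).ne'
    rw [pPlus_eq hα hμ hc, Real.tan_arctan, Real.cos_sq_arctan, one_div, one_div]
    congr 1
    rw [← hudef, ← hDdef]
    simp only [hq]
    have : N σ = D - x₀ * (1 - Real.exp (-(D * σ))) := rfl
    have hx : x₀ * Real.exp (-(D * σ)) = N σ - D + x₀ := by rw [this]; ring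
    field_simp
    linear_combination (-x₀ * Real.exp (-(D * σ))) * hx
  · intro σ hσ
    have h1 := hqpos σ hσ
    have h2 := hqle σ hσ
    have hmono := Real.arctan_strictMono.monotone
    rw [hθ₀arc, hθ1] at hθ
    rw [hθ1]
    have hc := H.c_pos
    rcases le_total 0 x₀ with h | h
    · constructor
      · have : Real.arctan u ≤ Real.arctan (u + x₀ * q σ) := hmono (by nlinarith)
        linarith
      · have : Real.arctan (u + x₀ * q σ) ≤ Real.arctan (u + x₀) := hmono (by nlinarith)
        exact this.trans hθ.2
    · constructor
      · have : Real.arctan (u + x₀) ≤ Real.arctan (u + x₀ * q σ) := hmono (by nlinarith)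
        exact hθ.1.trans this
      · have : Real.arctan (u + x₀ * q σ) ≤ Real.arctan u := hmono (by nlinarith)
        linarith
  · intro σ hσ
    have hlip : |Real.arctan (u + x₀ * q σ) - Real.arctan u| ≤ |x₀ * q σ| := by
      have h := Convex.norm_image_sub_le_of_norm_hasDerivWithin_le (f := Real.arctan)
        (f' := fun x => 1 / (1 + x ^ 2)) (C := 1) (s := univ) (x := u) (y := u + x₀ * q σ)
        (fun x _ => (Real.hasDerivAt_arctan x).hasDerivWithinAt) (fun x _ => ?_) convex_univ
        (mem_univ _) (mem_univ _)
      · simpa using h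
      · rw [Real.norm_of_nonneg (by positivity), div_le_one (by positivity)]
        nlinarith [sq_nonneg x]
    rw [hθ1]
    refine hlip.trans ?_
    rw [abs_mul, abs_of_pos (hqpos σ hσ)]
    calc |x₀| * q σ ≤ D / 2 * (2 * Real.exp (-(D * σ))) :=
          mul_le_mul hx₀D (hqle2 σ hσ) (hqpos σ hσ).le (by linarith)
      _ = D * Real.exp (-(D * σ)) := by ring
  · intro hlt σ hσ
    have hx : x₀ < 0 := sub_neg.2 ((H.tan_lt_iff hθ).2 hlt)
    rw [hθ1]
    exact Real.arctan_strictMono (by nlinarith [hqpos σ hσ])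

lemma continuous_relaxRate (α μ : ℝ) : Continuous (relaxRate α μ) := by
  unfold relaxRate cPlus; fun_prop

lemma relaxRate_mul_target {α μ θ φ : ℝ} (hs : Real.sin θ ≠ 0) :
    relaxRate α μ θ * (1 / Real.sin θ - φ ^ 2) = -(2 * (cPlus α μ θ * b θ φ)) := by
  unfold relaxRate b
  field_simp
  ring

/-- Every point of a trapping rectangle has a forward orbit in the time `σ`; it stays in the
rectangle and tends to `P`, the angle at the exponential rate `gap`. -/
lemma exists_orbit {α μ c δ : ℝ} (hα : 0 < α) (hμ : muP α < μ) (H : IsTrapping α μ c δ)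
    {x : ℝ × ℝ} (hx : x ∈ box α μ c δ) :
    ∃ Y : ℝ → ℝ × ℝ, Y 0 = x ∧ IsSolutionOn (angleField α μ) Y (Ici 0) ∧
      (∀ σ ∈ Ici (0 : ℝ), Y σ ∈ box α μ c δ) ∧ Tendsto Y atTop (𝓝 (pointP α μ)) ∧
      (∀ σ ∈ Ici (0 : ℝ), |(Y σ).1 - theta1 α μ| ≤ gap α μ * Real.exp (-(gap α μ * σ))) ∧
      (x.1 < theta1 α μ → ∀ σ ∈ Ici (0 : ℝ), (Y σ).1 < theta1 α μ) := by
  obtain ⟨θ, hθ0, hθd, hθm, hθe, hθl⟩ := exists_angle_solution hα hμ H hx.1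
  have hθc : ContinuousOn θ (Ici 0) := fun σ hσ =>
    (hθd σ hσ).continuousAt.continuousWithinAt
  have hac : ContinuousOn (fun σ => relaxRate α μ (θ σ)) (Ici 0) :=
    (continuous_relaxRate α μ).comp_continuousOn hθc
  have hec : ContinuousOn (fun σ => 1 / Real.sin (θ σ)) (Ici 0) :=
    continuousOn_const.div (Real.continuous_sin.comp_continuousOn hθc)
      fun σ hσ => (H.sin_pos (hθm σ hσ)).ne'
  obtain ⟨w, hw0, hw⟩ := exists_linear_solution hac hec (x.2 ^ 2)
  have hu := slope_pos hα hμ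
  have hδ := sub_pos.2 H.δ_lt
  have hδ0 := H.δ_pos
  have ha0 : ∀ σ ∈ Ici (0 : ℝ), 0 ≤ relaxRate α μ (θ σ) := fun σ hσ =>
    hu.le.trans (H.rate_ge _ (hθm σ hσ))
  have hx2 := hx.2
  have hwge := linear_solution_ge hac ha0 (fun σ hσ => H.target_ge _ (hθm σ hσ))
    (by rw [hw0]; exact pow_le_pow_left₀ hδ.le hx2.1 2) hw
  have hwle := linear_solution_le hac ha0 (fun σ hσ => H.target_le _ (hθm σ hσ))
    (by rw [hw0]; exact pow_le_pow_left₀ (H.snd_pos hx).le hx2.2 2) hw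
  have hwpos : ∀ σ ∈ Ici (0 : ℝ), 0 < w σ := fun σ hσ => (pow_pos hδ 2).trans_le (hwge σ hσ)
  have hθt : Tendsto θ atTop (𝓝 (theta1 α μ)) := by
    rw [tendsto_iff_norm_sub_tendsto_zero]
    have h1 : Tendsto (fun σ => gap α μ * Real.exp (-(gap α μ * σ))) atTop (𝓝 0) := by
      simpa using (Real.tendsto_exp_neg_atTop_nhds_zero.comp
        (tendsto_id.const_mul_atTop (gap_pos hα hμ))).const_mul (gap α μ)
    exact squeeze_zero' (Eventually.of_forall fun σ => norm_nonneg _)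
      ((eventually_ge_atTop 0).mono fun σ hσ => hθe σ hσ) h1
  have het : Tendsto (fun σ => 1 / Real.sin (θ σ)) atTop
      (𝓝 (1 / Real.sin (theta1 α μ))) :=
    tendsto_const_nhds.div ((Real.continuous_sin.tendsto _).comp hθt) (sin_theta1_pos hα hμ).ne'
  have hwt := linear_solution_tendsto hac hu (fun σ hσ => H.rate_ge _ (hθm σ hσ)) het hw
  refine ⟨fun σ => (θ σ, Real.sqrt (w σ)), ?_, ?_, ?_, ?_, hθe, ?_⟩
  · simp only [hθ0, hw0, Real.sqrt_sq (H.snd_pos hx).le]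
  · intro σ hσ
    have h1 := (hw σ hσ).sqrt (hwpos σ hσ).ne'
    refine ((hθd σ hσ).hasDerivWithinAt.prodMk h1).congr_deriv ?_
    have h2 := relaxRate_mul_target (α := α) (μ := μ) (φ := Real.sqrt (w σ))
      (H.sin_pos (hθm σ hσ)).ne'
    rw [Real.sq_sqrt (hwpos σ hσ).le] at h2
    have h3 := (Real.sqrt_pos.2 (hwpos σ hσ)).ne'
    simp only [angleField, Prod.mk.injEq, true_and]
    rw [h2]
    field_simp
  · intro σ hσ
    refine ⟨hθm σ hσ, ?_, ?_⟩
    · exact Real.le_sqrt_of_sq_le (hwge σ hσ)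
    · exact Real.sqrt_le_iff.2 ⟨by linarith, hwle σ hσ⟩
  · exact hθt.prodMk_nhds ((Real.continuous_sqrt.tendsto _).comp hwt)
  · intro h σ hσ
    exact hθl h σ hσ

/-! ### Distance to the invariant curve along orbits -/

/-- The conditions on the invariant curve `φ² = M(θ)` and on the rectangle `box α μ c δ` that are
used for the strong stable manifold: the curve lies in the rectangle, it crosses `b = 0` only at
`P`, and the relaxation of `φ²` is slower than that of `θ`. -/
structure IsInvariantCurve (α μ c δ : ℝ) (M : ℝ → ℝ) : Prop where
  smooth : ContDiffOn ℝ ∞ M (Icc (theta1 α μ - c) (theta1 α μ + c))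
  hasDerivAt : ∀ θ ∈ Icc (theta1 α μ - c) (theta1 α μ + c), HasDerivAt M (deriv M θ) θ
  ode : ∀ θ ∈ Icc (theta1 α μ - c) (theta1 α μ + c),
    pPlus α μ θ * deriv M θ = relaxRate α μ θ * (1 / Real.sin θ - M θ)
  value : M (theta1 α μ) = 1 / Real.sin (theta1 α μ)
  mem : ∀ θ ∈ Icc (theta1 α μ - c) (theta1 α μ + c),
    M θ ∈ Icc ((phi1 α μ - δ) ^ 2) ((phi1 α μ + δ) ^ 2)
  lt_left : ∀ θ ∈ Icc (theta1 α μ - c) (theta1 α μ + c), θ < theta1 α μ → M θ < 1 / Real.sin θ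
  lt_right : ∀ θ ∈ Icc (theta1 α μ - c) (theta1 α μ + c), theta1 α μ < θ → 1 / Real.sin θ < M θ
  rate_lt : ∃ k < gap α μ, ∀ θ ∈ Icc (theta1 α μ - c) (theta1 α μ + c), relaxRate α μ θ ≤ k
  speed : 2 * slope α μ * phi1 α μ < gap α μ * (phi1 α μ - δ)

lemma IsInvariantCurve.pos {α μ c δ : ℝ} {M : ℝ → ℝ} (HM : IsInvariantCurve α μ c δ M)
    (H : IsTrapping α μ c δ) : ∀ θ ∈ Icc (theta1 α μ - c) (theta1 α μ + c), 0 < M θ :=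
  fun θ hθ => (pow_pos (sub_pos.2 H.δ_lt) 2).trans_le (HM.mem θ hθ).1

lemma desingularizedField_eq {α μ : ℝ} {x : ℝ × ℝ} (hx : 0 < x.2) :
    desingularizedField α μ x = x.2 • angleField α μ x := by
  simp only [desingularizedField, angleField, Prod.smul_mk, smul_eq_mul, Prod.mk.injEq]
  constructor
  · ring
  · field_simp

lemma reducedField_eq {α μ : ℝ} {x : ℝ × ℝ} (hx : 0 < x.2) (hp : pPlus α μ x.1 ≠ 0) :
    reducedField α μ x = (pPlus α μ x.1 / x.2)⁻¹ • angleField α μ x := by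
  simp only [reducedField, angleField, Prod.smul_mk, smul_eq_mul, Prod.mk.injEq]
  constructor <;> field_simp

lemma hasDerivWithinAt_fst {Z : ℝ → ℝ × ℝ} {v : ℝ × ℝ} {S : Set ℝ} {t : ℝ}
    (hZ : HasDerivWithinAt Z v S t) : HasDerivWithinAt (fun t => (Z t).1) v.1 S t :=
  ((ContinuousLinearMap.fst ℝ ℝ ℝ).hasFDerivAt.comp_hasDerivWithinAt t hZ)

lemma hasDerivWithinAt_snd {Z : ℝ → ℝ × ℝ} {v : ℝ × ℝ} {S : Set ℝ} {t : ℝ}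
    (hZ : HasDerivWithinAt Z v S t) : HasDerivWithinAt (fun t => (Z t).2) v.2 S t :=
  ((ContinuousLinearMap.snd ℝ ℝ ℝ).hasFDerivAt.comp_hasDerivWithinAt t hZ)

lemma hasDerivWithinAt_sq_snd {α μ ρ : ℝ} {Z : ℝ → ℝ × ℝ} {S : Set ℝ} {t : ℝ}
    (hZ : HasDerivWithinAt Z (ρ • angleField α μ (Z t)) S t) (hφ : 0 < (Z t).2)
    (hs : Real.sin (Z t).1 ≠ 0) :
    HasDerivWithinAt (fun t => (Z t).2 ^ 2)
      (ρ * (relaxRate α μ (Z t).1 * (1 / Real.sin (Z t).1 - (Z t).2 ^ 2))) S t := by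
  refine ((hasDerivWithinAt_snd hZ).pow 2).congr_deriv ?_
  rw [relaxRate_mul_target hs]
  simp only [angleField, Prod.smul_mk, smul_eq_mul]
  field_simp
  push_cast
  ring

/-- In every time, the defect `φ² - M(θ)` satisfies a homogeneous linear equation. -/
lemma hasDerivWithinAt_defect {α μ c δ ρ : ℝ} {M : ℝ → ℝ} (H : IsTrapping α μ c δ)
    (HM : IsInvariantCurve α μ c δ M) {Z : ℝ → ℝ × ℝ} {S : Set ℝ} {t : ℝ}
    (hZ : HasDerivWithinAt Z (ρ • angleField α μ (Z t)) S t) (hm : Z t ∈ box α μ c δ) :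
    HasDerivWithinAt (fun t => (Z t).2 ^ 2 - M (Z t).1)
      (-(ρ * relaxRate α μ (Z t).1 * ((Z t).2 ^ 2 - M (Z t).1))) S t := by
  have h1 := hasDerivWithinAt_sq_snd hZ (H.snd_pos hm) (H.sin_pos hm.1).ne'
  have h2 := (HM.hasDerivAt _ hm.1).comp_hasDerivWithinAt t (hasDerivWithinAt_fst hZ)
  refine (h1.sub h2).congr_deriv ?_
  have h3 := HM.ode _ hm.1
  simp only [angleField, Prod.smul_mk, smul_eq_mul]
  linear_combination (-ρ) * h3

lemma exists_bound_of_contDiffOn {E : Type*} [NormedAddCommGroup E] [NormedSpace ℝ E]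
    {f : E → ℝ} {s : Set E} {p : E} (hf : ContDiffOn ℝ 1 f s) (hs : Convex ℝ s)
    (hs' : IsCompact s) (hp : p ∈ s) : ∃ K ≥ 0, ∀ x ∈ s, |f x - f p| ≤ K * ‖x - p‖ := by
  obtain ⟨K, hK⟩ := hf.exists_lipschitzOnWith one_ne_zero hs hs'
  exact ⟨K, K.2, fun x hx => by simpa [dist_eq_norm] using hK.dist_le_mul x hx p hp⟩

lemma pointP_mem_box {α μ c δ : ℝ} (H : IsTrapping α μ c δ) : pointP α μ ∈ box α μ c δ :=
  ⟨H.theta1_mem, by constructor <;> simp [pointP, H.δ_pos.le]⟩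

lemma convex_box (α μ c δ : ℝ) : Convex ℝ (box α μ c δ) := (convex_Icc _ _).prod (convex_Icc _ _)

lemma isCompact_box (α μ c δ : ℝ) : IsCompact (box α μ c δ) := isCompact_Icc.prod isCompact_Icc

/-! ### Orbits in the time `τ` and the strong stable manifold -/

/-- Forward orbits in the time `τ`, as orbits in the time `σ ≥ (φ₁⁺ - δ) τ`. -/
lemma exists_desingularized_orbit {α μ c δ : ℝ} (hα : 0 < α) (hμ : muP α < μ)
    (H : IsTrapping α μ c δ) {x : ℝ × ℝ} (hx : x ∈ box α μ c δ) :
    ∃ X : ℝ → ℝ × ℝ, X 0 = x ∧ IsSolutionOn (desingularizedField α μ) X (Ici 0) ∧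
      (∀ τ ∈ Ici (0 : ℝ), X τ ∈ box α μ c δ) ∧ Tendsto X atTop (𝓝 (pointP α μ)) ∧
      ∀ τ ∈ Ici (0 : ℝ), |(X τ).1 - theta1 α μ| ≤
        gap α μ * Real.exp (-(gap α μ * ((phi1 α μ - δ) * τ))) := by
  obtain ⟨Y, hY0, hY, hYm, hYt, hYe, -⟩ := exists_orbit hα hμ H hx
  have hYc : ContinuousOn Y (Ici 0) := fun σ hσ => (hY σ hσ).continuousWithinAt
  have hpos : ∀ σ ∈ Ici (0 : ℝ), 0 < (Y σ).2 := fun σ hσ => H.snd_pos (hYm σ hσ)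
  have hrc : ContinuousOn (fun σ => (Y σ).2⁻¹) (Ici 0) :=
    (continuous_snd.comp_continuousOn hYc).inv₀ fun σ hσ => (hpos σ hσ).ne'
  obtain ⟨s, g, hs0, hsc, hsm, hgs, hsd⟩ := exists_time_change hrc
    fun σ hσ => inv_pos.2 (hpos σ hσ)
  have hδ := sub_pos.2 H.δ_lt
  have hδ' : 0 < phi1 α μ + δ := by linarith [H.δ_pos]
  have hsge : ∀ σ ∈ Ici (0 : ℝ), σ * (phi1 α μ + δ)⁻¹ ≤ s σ := by
    have hm := monotoneOn_Ici_of_hasDerivWithinAt_nonneg (N := 0)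
      (f := fun σ => s σ - σ * (phi1 α μ + δ)⁻¹)
      (f' := fun σ => (Y σ).2⁻¹ - (phi1 α μ + δ)⁻¹)
      (fun σ hσ => (((hsd σ hσ).1.sub
        ((hasDerivAt_id σ).mul_const _)).hasDerivWithinAt).congr_deriv (by simp))
      (fun σ hσ => sub_nonneg.2 (inv_anti₀ (hpos σ hσ) (hYm σ hσ).2.2))
    intro σ hσ
    have := hm self_mem_Ici hσ hσ
    simp only [hs0, zero_mul, sub_zero] at this
    linarith
  have hsle : ∀ σ ∈ Ici (0 : ℝ), s σ ≤ σ * (phi1 α μ - δ)⁻¹ := by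
    have hm := monotoneOn_Ici_of_hasDerivWithinAt_nonneg (N := 0)
      (f := fun σ => σ * (phi1 α μ - δ)⁻¹ - s σ)
      (f' := fun σ => (phi1 α μ - δ)⁻¹ - (Y σ).2⁻¹)
      (fun σ hσ => ((((hasDerivAt_id σ).mul_const _).sub
        (hsd σ hσ).1).hasDerivWithinAt).congr_deriv (by simp))
      (fun σ hσ => sub_nonneg.2 (inv_anti₀ hδ (hYm σ hσ).2.1))
    intro σ hσ
    have := hm self_mem_Ici hσ hσ
    simp only [hs0, zero_mul, sub_zero] at this
    linarith
  have hs_top : Tendsto s atTop atTop :=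
    tendsto_atTop_mono' _ ((eventually_ge_atTop 0).mono fun σ hσ => hsge σ hσ)
      (tendsto_id.atTop_mul_const (inv_pos.2 hδ'))
  have hsurj := surj_of_tendsto_atTop hs0 hsc hs_top
  have hgt := tendsto_inverse_atTop hs0 hsc hsm hgs hs_top
  refine ⟨Y ∘ g, ?_, ?_, ?_, hYt.comp hgt, ?_⟩
  · have := hgs 0
    rw [hs0] at this
    simp [this, hY0]
  · intro τ hτ
    obtain ⟨σ, hσ, rfl⟩ := hsurj hτ
    have h := hasDerivWithinAt_time_change (r := fun σ => (Y σ).2⁻¹) hgs (hsd σ hσ).2 (hY σ hσ)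
    refine (h.mono hsurj).congr_deriv ?_
    simp only [Function.comp, hgs, inv_inv]
    rw [desingularizedField_eq (hpos σ hσ)]
  · intro τ hτ
    obtain ⟨σ, hσ, rfl⟩ := hsurj hτ
    simpa only [Function.comp, hgs] using hYm σ hσ
  · intro τ hτ
    obtain ⟨σ, hσ, rfl⟩ := hsurj hτ
    simp only [Function.comp, hgs]
    refine (hYe σ hσ).trans ?_
    have h1 := gap_pos hα hμ
    have h2 : (phi1 α μ - δ) * s σ ≤ σ := by
      have := mul_le_mul_of_nonneg_left (hsle σ hσ) hδ.le
      rwa [mul_comm σ, mul_inv_cancel_left₀ hδ.ne'] at this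
    gcongr

/-- A forward orbit in the time `τ` which tends to `P` faster than `exp (λ₂ τ)` lies on the
invariant curve: the defect `φ² - M(θ)` decays only like `exp (λ₂ τ)`. -/
lemma defect_eq_zero_of_isLittleO {α μ c δ : ℝ} {M : ℝ → ℝ} (hα : 0 < α) (hμ : muP α < μ)
    (H : IsTrapping α μ c δ) (HM : IsInvariantCurve α μ c δ M) {X : ℝ → ℝ × ℝ}
    (hX : IsSolutionOn (desingularizedField α μ) X (Ici 0))
    (hXm : ∀ τ ∈ Ici (0 : ℝ), X τ ∈ box α μ c δ)
    (hXo : (fun τ => X τ - pointP α μ) =o[atTop] fun τ => Real.exp (lam2 α μ * τ)) :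
    (X 0).2 ^ 2 - M (X 0).1 = 0 := by
  set y : ℝ → ℝ := fun τ => (X τ).2 ^ 2 - M (X τ).1 with hy
  set a : ℝ × ℝ → ℝ := fun x => x.2 * relaxRate α μ x.1 with ha
  set l := -lam2 α μ with hl
  have hl0 : 0 < l := neg_pos.2 (lam2_neg hα hμ)
  have hP := pointP_mem_box H
  have haP : a (pointP α μ) = l := by
    simp only [ha, hl, pointP, relaxRate_theta1 hα hμ, lam2_eq hα hμ]; ring
  have hyd : ∀ τ ∈ Ici (0 : ℝ), HasDerivWithinAt y (-(a (X τ) * y τ)) (Ici 0) τ := by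
    intro τ hτ
    refine hasDerivWithinAt_defect H HM (ρ := (X τ).2) ?_ (hXm τ hτ)
    rw [← desingularizedField_eq (H.snd_pos (hXm τ hτ))]
    exact hX τ hτ
  obtain ⟨K, hK0, hK⟩ := exists_bound_of_contDiffOn (f := a) (p := pointP α μ)
    (by simp only [ha]; unfold relaxRate cPlus; fun_prop) (convex_box α μ c δ)
    (isCompact_box α μ c δ) hP
  obtain ⟨L, hL0, hL⟩ := exists_bound_of_contDiffOn (f := fun x : ℝ × ℝ => x.2 ^ 2 - M x.1)
    (p := pointP α μ) (s := box α μ c δ)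
    (ContDiffOn.sub (by fun_prop) ((HM.smooth.of_le (by exact_mod_cast le_top)).comp
      contDiffOn_fst fun x hx => hx.1)) (convex_box α μ c δ) (isCompact_box α μ c δ) hP
  -- the estimate holds for all times because the orbit is bounded
  obtain ⟨C, hC0, hC⟩ : ∃ C ≥ 0, ∀ τ ∈ Ici (0 : ℝ),
      ‖X τ - pointP α μ‖ ≤ C * Real.exp (-(l * τ)) := by
    have h1 := hXo.bound one_pos
    obtain ⟨T, hT⟩ := eventually_atTop.1 h1
    obtain ⟨R, hR⟩ := (isCompact_box α μ c δ).isBounded.exists_norm_le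
    have hR0 : 0 ≤ R := (norm_nonneg _).trans (hR _ hP)
    refine ⟨1 + 2 * R * Real.exp (l * T), by positivity, fun τ hτ => ?_⟩
    rcases le_total T τ with h | h
    · refine (hT τ h).trans ?_
      rw [Real.norm_of_nonneg (Real.exp_pos _).le, one_mul,
        show lam2 α μ * τ = -(l * τ) by rw [hl]; ring]
      have : 0 ≤ 2 * R * Real.exp (l * T) := by positivity
      exact le_mul_of_one_le_left (Real.exp_pos _).le (by linarith)
    · have h2 : ‖X τ - pointP α μ‖ ≤ 2 * R :=
        (norm_sub_le _ _).trans (by linarith [hR _ (hXm τ hτ), hR _ hP])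
      have h3 : 1 ≤ Real.exp (l * T) * Real.exp (-(l * τ)) := by
        rw [← Real.exp_add]
        exact Real.one_le_exp (by nlinarith)
      have h4 := Real.exp_pos (-(l * τ))
      nlinarith [mul_le_mul_of_nonneg_left h3 (mul_nonneg zero_le_two hR0)]
  set B := 2 * (K * C) / l with hB
  -- a weight that turns the square of `y exp (l τ)` into a nondecreasing function
  have hmono : MonotoneOn (fun τ => (y τ * Real.exp (l * τ)) ^ 2 *
      Real.exp (-(B * Real.exp (-(l * τ))))) (Ici 0) := by
    have hE : ∀ τ : ℝ, HasDerivAt (fun τ => Real.exp (l * τ)) (l * Real.exp (l * τ)) τ := fun τ =>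
      (((hasDerivAt_id τ).const_mul l).exp).congr_deriv (by simp; ring)
    have hE' : ∀ τ : ℝ, HasDerivAt (fun τ => Real.exp (-(l * τ))) (-l * Real.exp (-(l * τ))) τ :=
      fun τ => (((hasDerivAt_id τ).const_mul l).neg.exp).congr_deriv (by simp; ring)
    refine monotoneOn_Ici_of_hasDerivWithinAt_nonneg (f' := fun τ =>
      (2 * (l - a (X τ)) + B * l * Real.exp (-(l * τ))) * (y τ * Real.exp (l * τ)) ^ 2 *
        Real.exp (-(B * Real.exp (-(l * τ))))) ?_ ?_
    · intro τ hτ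
      have h1 := ((hyd τ hτ).mul (hE τ).hasDerivWithinAt).pow 2
      have h2 := ((hE' τ).const_mul B).neg.exp.hasDerivWithinAt (s := Ici (0 : ℝ))
      refine (h1.mul h2).congr_deriv ?_
      simp only [Pi.mul_apply, Pi.pow_apply, Pi.neg_apply]
      push_cast
      ring
    · intro τ hτ
      have h1 : a (X τ) - l ≤ K * C * Real.exp (-(l * τ)) := by
        have h := (hK _ (hXm τ hτ)).trans (mul_le_mul_of_nonneg_left (hC τ hτ) hK0)
        rw [haP, ← mul_assoc] at h
        exact (le_abs_self _).trans h
      have h2 : B * l = 2 * (K * C) := div_mul_cancel₀ _ hl0.ne'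
      have h3 : 0 ≤ 2 * (l - a (X τ)) + B * l * Real.exp (-(l * τ)) := by rw [h2]; linarith
      positivity
  have hlim : Tendsto (fun τ => (y τ * Real.exp (l * τ)) ^ 2) atTop (𝓝 0) := by
    have hyO : y =o[atTop] fun τ => Real.exp (lam2 α μ * τ) := by
      refine IsBigO.trans_isLittleO (IsBigO.of_bound L ?_) hXo
      filter_upwards [eventually_ge_atTop 0] with τ hτ
      have h1 := hL _ (hXm τ hτ)
      have h2 : (pointP α μ).2 ^ 2 - M (pointP α μ).1 = 0 := by
        simp only [pointP, HM.value, phi1_sq hα hμ, sub_self]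
      rwa [h2, sub_zero] at h1
    have h1 := hyO.tendsto_div_nhds_zero
    have h2 : (fun τ => y τ / Real.exp (lam2 α μ * τ)) = fun τ => y τ * Real.exp (l * τ) := by
      funext τ
      rw [hl, neg_mul, Real.exp_neg, div_eq_mul_inv]
    rw [h2] at h1
    simpa using h1.pow 2
  have hle : (y 0 * Real.exp (l * 0)) ^ 2 * Real.exp (-(B * Real.exp (-(l * 0)))) ≤ 0 := by
    refine ge_of_tendsto hlim ?_
    filter_upwards [eventually_ge_atTop 0] with τ hτ
    refine (hmono self_mem_Ici hτ hτ).trans ?_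
    refine mul_le_of_le_one_right (sq_nonneg _) (Real.exp_le_one_iff.2 ?_)
    have : 0 ≤ B := by positivity
    have := mul_nonneg this (Real.exp_pos (-(l * τ))).le
    linarith
  have h1 := Real.exp_pos (-(B * Real.exp (-(l * 0))))
  have h2 : (y 0 * Real.exp (l * 0)) ^ 2 ≤ 0 := nonpos_of_mul_nonpos_left hle h1
  have h3 : y 0 * Real.exp (l * 0) = 0 := by
    exact pow_eq_zero_iff two_ne_zero |>.1 (le_antisymm h2 (sq_nonneg _))
  simpa using h3

lemma mem_box_of_curve {α μ c δ : ℝ} {M : ℝ → ℝ} (H : IsTrapping α μ c δ)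
    (HM : IsInvariantCurve α μ c δ M) {θ : ℝ}
    (hθ : θ ∈ Icc (theta1 α μ - c) (theta1 α μ + c)) : (θ, Real.sqrt (M θ)) ∈ box α μ c δ := by
  have h := HM.mem θ hθ
  exact ⟨hθ, Real.le_sqrt_of_sq_le h.1, Real.sqrt_le_iff.2
    ⟨by linarith [H.δ_pos, H.δ_lt], h.2⟩⟩

/-- The invariant curve is the local strong stable set. -/
lemma image_curve_eq {α μ c δ : ℝ} {M : ℝ → ℝ} (hα : 0 < α) (hμ : muP α < μ)
    (H : IsTrapping α μ c δ) (HM : IsInvariantCurve α μ c δ M) :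
    (fun θ => (θ, Real.sqrt (M θ))) '' Icc (theta1 α μ - c) (theta1 α μ + c) =
      localStrongStableSet (desingularizedField α μ) (pointP α μ) (lam2 α μ) (box α μ c δ) := by
  apply Subset.antisymm
  · rintro _ ⟨θ, hθ, rfl⟩
    obtain ⟨X, hX0, hX, hXm, -, hXe⟩ :=
      exists_desingularized_orbit hα hμ H (mem_box_of_curve H HM hθ)
    refine ⟨X, hX0, hX, hXm, ?_⟩
    have hXc : ContinuousOn X (Ici 0) := fun σ hσ => (hX σ hσ).continuousWithinAt
    obtain ⟨A, hA0, hA⟩ := exists_antideriv_Ici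
      (a := fun τ => (X τ).2 * relaxRate α μ (X τ).1)
      ((continuous_snd.comp_continuousOn hXc).mul ((continuous_relaxRate α μ).comp_continuousOn
        (continuous_fst.comp_continuousOn hXc)))
    have hy := homogeneous_solution_eq (y := fun τ => (X τ).2 ^ 2 - M (X τ).1) hA0 hA
      (fun τ hτ => hasDerivWithinAt_defect H HM (ρ := (X τ).2)
        (by rw [← desingularizedField_eq (H.snd_pos (hXm τ hτ))]; exact hX τ hτ) (hXm τ hτ))
    simp only [hX0, Real.sq_sqrt (HM.pos H θ hθ).le, sub_self, zero_mul] at hy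
    obtain ⟨L, hL0, hL⟩ := exists_bound_of_contDiffOn (HM.smooth.of_le (by exact_mod_cast le_top))
      (convex_Icc _ _) isCompact_Icc H.theta1_mem
    have hφ := phi1_pos hα hμ
    -- on the curve `φ - φ₁⁺` is controlled by `θ - θ₁`
    have hbd : ∀ τ ∈ Ici (0 : ℝ),
        ‖X τ - pointP α μ‖ ≤ (1 + L / phi1 α μ) * |(X τ).1 - theta1 α μ| := by
      intro τ hτ
      have h1 := hL _ (hXm τ hτ).1
      have h2 := H.snd_pos (hXm τ hτ)
      rw [← sub_eq_zero.1 (hy τ hτ), HM.value, ← phi1_sq hα hμ, sq_sub_sq, abs_mul,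
        abs_of_pos (show 0 < (X τ).2 + phi1 α μ by linarith), Real.norm_eq_abs] at h1
      have h3 : |(X τ).2 - phi1 α μ| ≤ L / phi1 α μ * |(X τ).1 - theta1 α μ| := by
        rw [div_mul_eq_mul_div, le_div_iff₀ hφ]
        nlinarith [abs_nonneg ((X τ).2 - phi1 α μ)]
      have h4 : 0 ≤ L / phi1 α μ := by positivity
      have h5 := abs_nonneg ((X τ).1 - theta1 α μ)
      rw [Prod.norm_def]
      refine max_le ?_ ?_
      · simp only [pointP, Prod.fst_sub, Real.norm_eq_abs]
        nlinarith
      · simp only [pointP, Prod.snd_sub, Real.norm_eq_abs]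
        nlinarith
    have hO : (fun τ => X τ - pointP α μ) =O[atTop]
        fun τ => Real.exp (-(gap α μ * ((phi1 α μ - δ) * τ))) := by
      refine IsBigO.of_bound ((1 + L / phi1 α μ) * gap α μ) ?_
      filter_upwards [eventually_ge_atTop 0] with τ hτ
      rw [Real.norm_of_nonneg (Real.exp_pos _).le, mul_assoc]
      exact (hbd τ hτ).trans (mul_le_mul_of_nonneg_left (hXe τ hτ) (by positivity))
    refine hO.trans_isLittleO (Real.isLittleO_exp_comp_exp_comp.2 ?_)
    have hsp := HM.speed
    rw [lam2_eq hα hμ]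
    have : (fun τ => -(2 * slope α μ * phi1 α μ) * τ - -(gap α μ * ((phi1 α μ - δ) * τ))) =
        fun τ : ℝ => (gap α μ * (phi1 α μ - δ) - 2 * slope α μ * phi1 α μ) * τ := by
      funext τ; ring
    rw [this]
    exact tendsto_id.const_mul_atTop (sub_pos.2 hsp)
  · rintro x ⟨X, rfl, hX, hXm, hXo⟩
    have h0 := hXm 0 self_mem_Ici
    refine ⟨(X 0).1, h0.1, ?_⟩
    have h1 := defect_eq_zero_of_isLittleO hα hμ H HM hX hXm hXo
    ext
    · rfl
    · simp only
      rw [← sub_eq_zero.1 h1, Real.sqrt_sq (H.snd_pos h0).le]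

/-! ### Orbits in the original time -/

/-- An orbit of the reduced system to the left of `θ₁`, as a change of time `t = s(σ)` of an orbit
`Y` in the time `σ`; `g` is the inverse of `s`. -/
lemma exists_reduced_orbit {α μ c δ : ℝ} (hα : 0 < α) (hμ : muP α < μ) (H : IsTrapping α μ c δ)
    {x : ℝ × ℝ} (hx : x ∈ box α μ c δ) (hx1 : x.1 < theta1 α μ) :
    ∃ (Y : ℝ → ℝ × ℝ) (s g : ℝ → ℝ), Y 0 = x ∧ IsSolutionOn (angleField α μ) Y (Ici 0) ∧
      (∀ σ ∈ Ici (0 : ℝ), Y σ ∈ box α μ c δ) ∧ Tendsto Y atTop (𝓝 (pointP α μ)) ∧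
      (∀ σ ∈ Ici (0 : ℝ), |(Y σ).1 - theta1 α μ| ≤ gap α μ * Real.exp (-(gap α μ * σ))) ∧
      (∀ σ ∈ Ici (0 : ℝ), 0 < pPlus α μ (Y σ).1) ∧
      s 0 = 0 ∧ Continuous s ∧ StrictMono s ∧ (∀ σ, g (s σ) = σ) ∧
      (∀ σ ∈ Ici (0 : ℝ), HasDerivAt s (pPlus α μ (Y σ).1 / (Y σ).2) σ) ∧
      IsSolutionOn (reducedField α μ) (Y ∘ g) (s '' Ici 0) := by
  obtain ⟨Y, hY0, hY, hYm, hYt, hYe, hYl⟩ := exists_orbit hα hμ H hx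
  have hYc : ContinuousOn Y (Ici 0) := fun σ hσ => (hY σ hσ).continuousWithinAt
  have hφ : ∀ σ ∈ Ici (0 : ℝ), 0 < (Y σ).2 := fun σ hσ => H.snd_pos (hYm σ hσ)
  have hp : ∀ σ ∈ Ici (0 : ℝ), 0 < pPlus α μ (Y σ).1 := fun σ hσ =>
    (H.pPlus_pos_iff hα hμ (hYm σ hσ).1).2 (hYl hx1 σ hσ)
  have hpc : Continuous (pPlus α μ) :=
    continuous_iff_continuousAt.2 fun θ => (hasDerivAt_pPlus α μ θ).continuousAt
  obtain ⟨s, g, hs0, hsc, hsm, hgs, hsd⟩ := exists_time_change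
    (r := fun σ => pPlus α μ (Y σ).1 / (Y σ).2)
    ((hpc.comp_continuousOn (continuous_fst.comp_continuousOn hYc)).div
      (continuous_snd.comp_continuousOn hYc) fun σ hσ => (hφ σ hσ).ne')
    fun σ hσ => div_pos (hp σ hσ) (hφ σ hσ)
  refine ⟨Y, s, g, hY0, hY, hYm, hYt, hYe, hp, hs0, hsc, hsm, hgs, fun σ hσ => (hsd σ hσ).1, ?_⟩
  rintro _ ⟨σ, hσ, rfl⟩
  refine (hasDerivWithinAt_time_change (r := fun σ => pPlus α μ (Y σ).1 / (Y σ).2) hgs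
    (hsd σ hσ).2 (hY σ hσ)).congr_deriv ?_
  simp only [Function.comp, hgs]
  rw [reducedField_eq (hφ σ hσ) (hp σ hσ).ne']

lemma b_eq_sin_mul {θ φ : ℝ} (hs : Real.sin θ ≠ 0) :
    b θ φ = Real.sin θ * (φ ^ 2 - 1 / Real.sin θ) := by
  unfold b; field_simp; ring

/-- The defect `φ² - M(θ)` keeps its sign and decays at most like `exp (-k σ)`, where `k` bounds
the relaxation rate from above. -/
lemma defect_lower_bound {α μ c δ k : ℝ} {M : ℝ → ℝ}
    (H : IsTrapping α μ c δ) (HM : IsInvariantCurve α μ c δ M)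
    (hk : ∀ θ ∈ Icc (theta1 α μ - c) (theta1 α μ + c), relaxRate α μ θ ≤ k)
    {Y : ℝ → ℝ × ℝ} (hY : IsSolutionOn (angleField α μ) Y (Ici 0))
    (hYm : ∀ σ ∈ Ici (0 : ℝ), Y σ ∈ box α μ c δ) :
    ∀ σ ∈ Ici (0 : ℝ), ∃ ρ ≥ Real.exp (-(k * σ)),
      (Y σ).2 ^ 2 - M (Y σ).1 = ((Y 0).2 ^ 2 - M (Y 0).1) * ρ := by
  have hYc : ContinuousOn Y (Ici 0) := fun σ hσ => (hY σ hσ).continuousWithinAt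
  obtain ⟨A, hA0, hA⟩ := exists_antideriv_Ici (a := fun σ => relaxRate α μ (Y σ).1)
    ((continuous_relaxRate α μ).comp_continuousOn (continuous_fst.comp_continuousOn hYc))
  have hy := homogeneous_solution_eq (y := fun σ => (Y σ).2 ^ 2 - M (Y σ).1) hA0 hA
    (fun σ hσ => (hasDerivWithinAt_defect H HM (ρ := 1)
      (by rw [one_smul]; exact hY σ hσ) (hYm σ hσ)).congr_deriv (by ring))
  have hm := monotoneOn_Ici_of_hasDerivWithinAt_nonneg (N := 0) (f := fun σ => k * σ - A σ)
    (f' := fun σ => k - relaxRate α μ (Y σ).1)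
    (fun σ hσ => ((((hasDerivAt_id σ).const_mul k).sub (hA σ hσ)).hasDerivWithinAt).congr_deriv
      (by simp)) (fun σ hσ => sub_nonneg.2 (hk _ (hYm σ hσ).1))
  intro σ hσ
  refine ⟨Real.exp (-A σ), Real.exp_le_exp.2 ?_, hy σ hσ⟩
  have := hm self_mem_Ici hσ hσ
  simp only [hA0, mul_zero, sub_zero] at this
  linarith

lemma tendsto_exp_gap {k D : ℝ} (hkD : k < D) :
    Tendsto (fun σ : ℝ => Real.exp ((k - D) * σ)) atTop (𝓝 0) :=
  Real.tendsto_exp_atBot.comp (tendsto_id.const_mul_atTop_of_neg (by linarith))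

/-- Above the strong stable manifold the orbit lifts off: the defect decays more slowly than the
distance between the curves `φ² = M(θ)` and `b = 0`, and `b` times an integrating factor is
strictly increasing. -/
lemma leavesThroughLiftOff_of_lt {α μ c δ : ℝ} {M : ℝ → ℝ} (hα : 0 < α) (hμ : muP α < μ)
    (H : IsTrapping α μ c δ) (HM : IsInvariantCurve α μ c δ M) {x : ℝ × ℝ}
    (hx : x ∈ regionT α μ (box α μ c δ)) (hlt : M x.1 < x.2 ^ 2) :
    LeavesThroughLiftOff α μ (box α μ c δ) x := by
  obtain ⟨⟨hxb, hxp⟩, hxm⟩ := hx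
  have hx1 := (H.pPlus_pos_iff hα hμ hxm.1).1 hxp
  obtain ⟨Y, s, g, hY0, hY, hYm, hYt, hYe, hYp, hs0, hsc, hsm, hgs, -, hX⟩ :=
    exists_reduced_orbit hα hμ H hxm hx1
  have hYc : ContinuousOn Y (Ici 0) := fun σ hσ => (hY σ hσ).continuousWithinAt
  obtain ⟨k, hkD, hk⟩ := HM.rate_lt
  have hdef := defect_lower_bound H HM hk hY hYm
  have hD := gap_pos hα hμ
  obtain ⟨L, hL0, hL⟩ := exists_bound_of_contDiffOn (p := theta1 α μ)
    (s := Icc (theta1 α μ - c) (theta1 α μ + c)) (f := fun θ => M θ - 1 / Real.sin θ)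
    (ContDiffOn.sub (HM.smooth.of_le (by exact_mod_cast le_top))
      (contDiffOn_const.div Real.contDiff_sin.contDiffOn fun θ hθ => (H.sin_pos hθ).ne'))
    (convex_Icc _ _) isCompact_Icc H.theta1_mem
  simp only [HM.value, sub_self, sub_zero, Real.norm_eq_abs] at hL
  -- eventually `b` is positive
  obtain ⟨σ₂, hσ₂, hb₂⟩ : ∃ σ ∈ Ici (0 : ℝ), 0 < b (Y σ).1 (Y σ).2 := by
    set y₀ := (Y 0).2 ^ 2 - M (Y 0).1 with hy₀
    have hy₀pos : 0 < y₀ := by rw [hy₀, hY0]; linarith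
    have hlim := (tendsto_exp_gap hkD).const_mul (L * gap α μ)
    rw [mul_zero] at hlim
    obtain ⟨σ, hσ, hσ0⟩ := ((hlim.eventually (eventually_lt_nhds hy₀pos)).and
      (eventually_ge_atTop 0)).exists
    refine ⟨σ, hσ0, ?_⟩
    rw [b_eq_sin_mul (H.sin_pos (hYm σ hσ0).1).ne']
    refine mul_pos (H.sin_pos (hYm σ hσ0).1) ?_
    obtain ⟨ρ, hρ, he⟩ := hdef σ hσ0
    have h1 := (abs_le.1 (hL _ (hYm σ hσ0).1)).1
    have h2 := mul_le_mul_of_nonneg_left (hYe σ hσ0) hL0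
    have h3 : y₀ * Real.exp (-(k * σ)) ≤ y₀ * ρ := mul_le_mul_of_nonneg_left hρ hy₀pos.le
    have h4 : L * (gap α μ * Real.exp (-(gap α μ * σ))) < y₀ * Real.exp (-(k * σ)) := by
      have : Real.exp (-(gap α μ * σ)) = Real.exp ((k - gap α μ) * σ) * Real.exp (-(k * σ)) := by
        rw [← Real.exp_add]; congr 1; ring
      rw [this, ← mul_assoc, ← mul_assoc]
      exact mul_lt_mul_of_pos_right hσ (Real.exp_pos _)
    linarith
  obtain ⟨A, hA0, hA⟩ := exists_antideriv_Ici (a := fun σ => relaxRate α μ (Y σ).1)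
    ((continuous_relaxRate α μ).comp_continuousOn (continuous_fst.comp_continuousOn hYc))
  set G : ℝ → ℝ := fun σ => b (Y σ).1 (Y σ).2 * Real.exp (A σ) with hG
  have hGd : ∀ σ ∈ Ici (0 : ℝ), HasDerivWithinAt G
      ((Y σ).2 ^ 2 * (pPlus α μ (Y σ).1 * Real.cos (Y σ).1) * Real.exp (A σ)) (Ici 0) σ := by
    intro σ hσ
    have h0 : HasDerivWithinAt Y ((1 : ℝ) • angleField α μ (Y σ)) (Ici 0) σ := by
      rw [one_smul]; exact hY σ hσ
    have hs := (H.sin_pos (hYm σ hσ).1).ne'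
    have h1 := hasDerivWithinAt_sq_snd h0 (H.snd_pos (hYm σ hσ)) hs
    have h2 := (Real.hasDerivAt_sin (Y σ).1).comp_hasDerivWithinAt σ (hasDerivWithinAt_fst h0)
    have h3 := ((h1.mul h2).const_add (-1)).mul ((hA σ hσ).exp.hasDerivWithinAt (s := Ici 0))
    refine h3.congr_deriv ?_
    simp only [one_smul, Function.comp, angleField, Pi.mul_apply]
    field_simp
    ring
  have hGc : ContinuousOn G (Ici 0) := fun σ hσ => (hGd σ hσ).continuousWithinAt
  have hGm : StrictMonoOn G (Ici 0) := by
    refine strictMonoOn_of_hasDerivWithinAt_pos (convex_Ici 0) hGc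
      (fun σ hσ => (hGd σ (interior_subset hσ)).mono interior_subset) fun σ hσ => ?_
    have hσ' := interior_subset hσ
    have h1 := H.snd_pos (hYm σ hσ')
    have h2 := hYp σ hσ'
    have h3 := H.cos_pos (hYm σ hσ').1
    positivity
  have hG0 : G 0 < 0 := by simpa [hG, hA0, hY0] using hxb
  have hG2 : 0 < G σ₂ := mul_pos hb₂ (Real.exp_pos _)
  obtain ⟨σ₁, hσ₁, hGσ₁⟩ := intermediate_value_Icc (mem_Ici.1 hσ₂)
    (hGc.mono Icc_subset_Ici_self) ⟨hG0.le, hG2.le⟩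
  have hσ₁0 : σ₁ ∈ Ici (0 : ℝ) := hσ₁.1
  have hσ₁pos : 0 < σ₁ := by
    rcases (mem_Ici.1 hσ₁0).eq_or_lt with h | h
    · rw [← h] at hGσ₁; linarith
    · exact h
  have hneg : ∀ σ ∈ Ici (0 : ℝ), σ < σ₁ → b (Y σ).1 (Y σ).2 < 0 := fun σ hσ h =>
    neg_of_mul_neg_left (hGσ₁ ▸ hGm hσ hσ₁0 h) (Real.exp_pos (A σ)).le
  have hpos : ∀ σ ∈ Ici (0 : ℝ), σ₁ < σ → 0 < b (Y σ).1 (Y σ).2 := fun σ hσ h =>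
    pos_of_mul_pos_left (hGσ₁ ▸ hGm hσ₁0 hσ h) (Real.exp_pos (A σ)).le
  have hzero : b (Y σ₁).1 (Y σ₁).2 = 0 :=
    (mul_eq_zero.1 hGσ₁).resolve_right (Real.exp_pos _).ne'
  have hsurj : ∀ t ∈ Ico 0 (s (σ₁ + 1)), ∃ σ ∈ Ici (0 : ℝ), s σ = t := by
    intro t ht
    obtain ⟨σ, hσ, rfl⟩ := intermediate_value_Icc (show (0 : ℝ) ≤ σ₁ + 1 by linarith)
      hsc.continuousOn ⟨hs0.trans_le ht.1, ht.2.le⟩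
    exact ⟨σ, hσ.1, rfl⟩
  have hlt1 : s σ₁ < s (σ₁ + 1) := hsm (lt_add_one σ₁)
  refine ⟨Y ∘ g, s σ₁, s (σ₁ + 1), hs0 ▸ hsm hσ₁pos, hlt1, ?_, ?_, ?_, ?_, ?_⟩
  · have := hgs 0
    rw [hs0] at this
    simp [this, hY0]
  · intro t ht
    obtain ⟨σ, hσ, rfl⟩ := hsurj t ht
    exact (hX _ ⟨σ, hσ, rfl⟩).mono hsurj
  · intro t ht
    obtain ⟨σ, hσ, rfl⟩ := hsurj t ⟨ht.1, ht.2.trans hlt1⟩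
    simp only [Function.comp, hgs]
    exact ⟨⟨hneg σ hσ (hsm.lt_iff_lt.1 ht.2), hYp σ hσ⟩, hYm σ hσ⟩
  · simp only [Function.comp, hgs]
    exact ⟨hYm _ hσ₁0, hzero, hYp _ hσ₁0⟩
  · intro t ht
    obtain ⟨σ, hσ, rfl⟩ := hsurj t ⟨(hs0 ▸ hsm hσ₁pos).le.trans ht.1.le, ht.2⟩
    simp only [Function.comp, hgs]
    exact ⟨hpos σ hσ (hsm.lt_iff_lt.1 ht.1), hYp σ hσ⟩

/-- Below the strong stable manifold the orbit reaches `P` in finite time, and since the defect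
decays more slowly than `θ - θ₁` it does so vertically. -/
lemma leavesThroughPVertically_of_lt {α μ c δ : ℝ} {M : ℝ → ℝ} (hα : 0 < α) (hμ : muP α < μ)
    (H : IsTrapping α μ c δ) (HM : IsInvariantCurve α μ c δ M) {x : ℝ × ℝ}
    (hx : x ∈ regionT α μ (box α μ c δ)) (hlt : x.2 ^ 2 < M x.1) :
    LeavesThroughPVertically α μ (box α μ c δ) x := by
  obtain ⟨⟨hxb, hxp⟩, hxm⟩ := hx
  have hx1 := (H.pPlus_pos_iff hα hμ hxm.1).1 hxp
  obtain ⟨Y, s, g, hY0, hY, hYm, hYt, hYe, hYp, hs0, hsc, hsm, hgs, hsd, hX⟩ :=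
    exists_reduced_orbit hα hμ H hxm hx1
  obtain ⟨k, hkD, hk⟩ := HM.rate_lt
  have hdef := defect_lower_bound H HM hk hY hYm
  have hD := gap_pos hα hμ
  have hδ := sub_pos.2 H.δ_lt
  have hφ1 := phi1_pos hα hμ
  set y₀ := (Y 0).2 ^ 2 - M (Y 0).1 with hy₀
  have hy₀neg : y₀ < 0 := by rw [hy₀, hY0]; linarith
  have hYl : ∀ σ ∈ Ici (0 : ℝ), (Y σ).1 < theta1 α μ := fun σ hσ =>
    (H.pPlus_pos_iff hα hμ (hYm σ hσ).1).1 (hYp σ hσ)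
  have hb : ∀ σ ∈ Ici (0 : ℝ), b (Y σ).1 (Y σ).2 < 0 := by
    intro σ hσ
    rw [b_eq_sin_mul (H.sin_pos (hYm σ hσ).1).ne']
    refine mul_neg_of_pos_of_neg (H.sin_pos (hYm σ hσ).1) ?_
    obtain ⟨ρ, hρ, he⟩ := hdef σ hσ
    have h1 : y₀ * ρ < 0 := mul_neg_of_neg_of_pos hy₀neg ((Real.exp_pos _).trans_le hρ)
    have h2 := HM.lt_left _ (hYm σ hσ).1 (hYl σ hσ)
    linarith
  -- the time `t` stays bounded because `dθ/dt = φ` is bounded below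
  obtain ⟨S, hS⟩ : ∃ S, Tendsto s atTop (𝓝 S) := by
    refine (tendsto_atTop_of_monotone hsm.monotone).resolve_left fun htop => ?_
    have hm := monotoneOn_Ici_of_hasDerivWithinAt_nonneg (N := 0)
      (f := fun σ => (Y σ).1 - (phi1 α μ - δ) * s σ)
      (f' := fun σ => pPlus α μ (Y σ).1 - (phi1 α μ - δ) * (pPlus α μ (Y σ).1 / (Y σ).2))
      (fun σ hσ => (hasDerivWithinAt_fst (hY σ hσ)).sub
        ((hsd σ hσ).const_mul _).hasDerivWithinAt) ?_
    · obtain ⟨σ, hσ, hσ0⟩ := ((htop.eventually_gt_atTop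
        ((theta1 α μ - (Y 0).1) / (phi1 α μ - δ))).and (eventually_ge_atTop 0)).exists
      have h1 := hm self_mem_Ici hσ0 hσ0
      simp only [hs0, mul_zero, sub_zero] at h1
      rw [div_lt_iff₀ hδ] at hσ
      linarith [hYl σ hσ0]
    · intro σ hσ
      have h1 := H.snd_pos (hYm σ hσ)
      have h2 := (hYm σ hσ).2.1
      have h3 := hYp σ hσ
      rw [sub_nonneg, mul_div_assoc', div_le_iff₀ h1, mul_comm]
      exact mul_le_mul_of_nonneg_left h2 h3.le
  have hsurj := surj_of_tendsto_nhds hs0 hsc hS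
  have hgt := tendsto_inverse_nhdsLT hs0 hsc hsm hgs hS
  refine ⟨Y ∘ g, S, hs0 ▸ lt_of_tendsto_strictMono hsm hS 0, ?_, ?_, ?_, hYt.comp hgt, ?_⟩
  · have := hgs 0
    rw [hs0] at this
    simp [this, hY0]
  · intro t ht
    exact (hX t (hsurj ht)).mono hsurj
  · intro t ht
    obtain ⟨σ, hσ, rfl⟩ := hsurj ht
    simp only [Function.comp, hgs]
    exact ⟨⟨hb σ hσ, hYp σ hσ⟩, hYm σ hσ⟩
  · suffices h : (fun σ => (Y σ).1 - theta1 α μ) =o[atTop] fun σ => (Y σ).2 - phi1 α μ from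
      h.comp_tendsto hgt
    obtain ⟨L, hL0, hL⟩ := exists_bound_of_contDiffOn
      (HM.smooth.of_le (by exact_mod_cast le_top)) (convex_Icc _ _) isCompact_Icc H.theta1_mem
    have hexp : (fun σ => (Y σ).1 - theta1 α μ) =o[atTop] fun σ => Real.exp (-(k * σ)) := by
      have h1 : (fun σ => (Y σ).1 - theta1 α μ) =O[atTop]
          fun σ => Real.exp (-(gap α μ * σ)) := by
        refine IsBigO.of_bound (gap α μ) ?_
        filter_upwards [eventually_ge_atTop 0] with σ hσ
        rw [Real.norm_of_nonneg (Real.exp_pos _).le]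
        exact hYe σ hσ
      refine h1.trans_isLittleO (Real.isLittleO_exp_comp_exp_comp.2 ?_)
      have : (fun σ => -(k * σ) - -(gap α μ * σ)) = fun σ : ℝ => (gap α μ - k) * σ := by
        funext σ; ring
      rw [this]
      exact tendsto_id.const_mul_atTop (sub_pos.2 hkD)
    refine hexp.trans_isBigO (IsBigO.of_bound
      (2 * (2 * phi1 α μ + δ) / -y₀) ?_)
    have hsmall := hexp.bound (c := -y₀ / (2 * (L + 1))) (by
      apply div_pos <;> linarith)
    filter_upwards [hsmall, eventually_ge_atTop 0] with σ h1 hσ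
    rw [Real.norm_of_nonneg (Real.exp_pos _).le] at h1 ⊢
    obtain ⟨ρ, hρ, he⟩ := hdef σ hσ
    have h2 := hL _ (hYm σ hσ).1
    rw [HM.value, ← phi1_sq hα hμ] at h2
    set E := Real.exp (-(k * σ)) with hE
    have hE0 : 0 < E := Real.exp_pos _
    have h3 : L * ‖(Y σ).1 - theta1 α μ‖ ≤ -y₀ / 2 * E := by
      have h4 : L * ‖(Y σ).1 - theta1 α μ‖ ≤ (L + 1) * (-y₀ / (2 * (L + 1)) * E) :=
        mul_le_mul (by linarith) h1 (norm_nonneg _) (by linarith)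
      have h5 : (L + 1) * (-y₀ / (2 * (L + 1)) * E) = -y₀ / 2 * E := by
        have : L + 1 ≠ 0 := by positivity
        field_simp
      linarith
    have h6 : -y₀ * E ≤ -y₀ * ρ := mul_le_mul_of_nonneg_left hρ (by linarith)
    have h7 : -y₀ / 2 * E ≤ phi1 α μ ^ 2 - (Y σ).2 ^ 2 := by
      have := (abs_le.1 (h2.trans h3)).2
      linarith
    have h8 := H.snd_pos (hYm σ hσ)
    have h9 : phi1 α μ ^ 2 - (Y σ).2 ^ 2 ≤ (2 * phi1 α μ + δ) * ‖(Y σ).2 - phi1 α μ‖ := by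
      rw [sq_sub_sq]
      refine mul_le_mul (by linarith [(hYm σ hσ).2.2]) ?_ ?_ (by linarith [H.δ_pos])
      · rw [Real.norm_eq_abs, abs_sub_comm]; exact le_abs_self _
      · have : 0 < -y₀ / 2 * E := mul_pos (by linarith) hE0
        rw [sq_sub_sq] at h7
        exact (pos_of_mul_pos_right (this.trans_le h7) (by linarith)).le
    rw [div_mul_eq_mul_div, le_div_iff₀ (by linarith)]
    linarith

/-! ### Choice of the rectangle -/

lemma eventually_forall_Icc {p : ℝ → Prop} {a : ℝ} (h : ∀ᶠ θ in 𝓝 a, p θ) :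
    ∀ᶠ c in 𝓝[>] (0 : ℝ), ∀ θ ∈ Icc (a - c) (a + c), p θ := by
  obtain ⟨ρ, hρ, hball⟩ := Metric.eventually_nhds_iff_ball.1 h
  rw [Real.ball_eq_Ioo] at hball
  filter_upwards [Ioo_mem_nhdsGT hρ] with c hc θ hθ
  exact hball θ ⟨by linarith [hθ.1, hc.2], by linarith [hθ.2, hc.2]⟩

lemma continuousAt_target {α μ : ℝ} (hα : 0 < α) (hμ : muP α < μ) :
    ContinuousAt (fun θ => 1 / Real.sin θ) (theta1 α μ) :=
  continuousAt_const.div Real.continuous_sin.continuousAt (sin_theta1_pos hα hμ).ne'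

lemma target_mem_Ioo {α μ δ : ℝ} (hα : 0 < α) (hμ : muP α < μ) (hδ0 : 0 < δ)
    (hδ : δ < phi1 α μ) :
    1 / Real.sin (theta1 α μ) ∈ Ioo ((phi1 α μ - δ) ^ 2) ((phi1 α μ + δ) ^ 2) := by
  rw [← phi1_sq hα hμ]
  constructor <;> nlinarith

lemma eventually_isTrapping {α μ δ : ℝ} (hα : 0 < α) (hμ : muP α < μ) (hδ0 : 0 < δ)
    (hδ : δ < phi1 α μ) : ∀ᶠ c in 𝓝[>] (0 : ℝ), IsTrapping α μ c δ := by
  have hD := gap_pos hα hμ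
  have hu := slope_pos hα hμ
  have h1 : ∀ᶠ θ in 𝓝 (theta1 α μ), θ ∈ Ioo 0 (Real.pi / 2) :=
    Ioo_mem_nhds (theta1_pos hα hμ) (theta1_lt α μ)
  have h2 : ∀ᶠ θ in 𝓝 (theta1 α μ), |Real.tan θ - slope α μ| < gap α μ / 2 := by
    have hc : ContinuousAt (fun θ => |Real.tan θ - slope α μ|) (theta1 α μ) :=
      ((Real.continuousAt_tan.2 (cos_theta1_pos α μ).ne').sub continuousAt_const).abs
    exact hc.eventually_lt_const (by simpa [tan_theta1] using hD)
  have h3 : ∀ᶠ θ in 𝓝 (theta1 α μ), slope α μ < relaxRate α μ θ :=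
    (continuous_relaxRate α μ).continuousAt.eventually_const_lt
      (by rw [relaxRate_theta1 hα hμ]; linarith)
  have h4 := (continuousAt_target hα hμ).eventually_mem
    (Ioo_mem_nhds (target_mem_Ioo hα hμ hδ0 hδ).1 (target_mem_Ioo hα hμ hδ0 hδ).2)
  filter_upwards [eventually_forall_Icc (h1.and (h2.and (h3.and h4))), self_mem_nhdsWithin]
    with c hc hc0
  exact
    { c_pos := hc0
      δ_pos := hδ0
      δ_lt := hδ
      angle_pos := fun θ hθ => (hc θ hθ).1.1
      angle_lt := fun θ hθ => (hc θ hθ).1.2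
      tan_near := fun θ hθ => (hc θ hθ).2.1.le
      rate_ge := fun θ hθ => (hc θ hθ).2.2.1.le
      target_ge := fun θ hθ => (hc θ hθ).2.2.2.1.le
      target_le := fun θ hθ => (hc θ hθ).2.2.2.2.le }

/-- The slope of the invariant curve at `θ₁`, obtained by differentiating its equation. -/
lemma deriv_curve {α μ r : ℝ} {M : ℝ → ℝ} (hα : 0 < α) (hμ : muP α < μ) (hr : 0 < r)
    (hξ : 2 * slope α μ < gap α μ)
    (hM : ContDiffOn ℝ ∞ M (Ioo (theta1 α μ - r) (theta1 α μ + r)))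
    (hM1 : M (theta1 α μ) = 1 / Real.sin (theta1 α μ))
    (hode : ∀ θ ∈ Ioo (theta1 α μ - r) (theta1 α μ + r),
      pPlus α μ θ * deriv M θ = relaxRate α μ θ * (1 / Real.sin θ - M θ)) :
    deriv M (theta1 α μ) = 2 * phi1 α μ ^ 2 / (gap α μ - 2 * slope α μ) := by
  have hnhds : Ioo (theta1 α μ - r) (theta1 α μ + r) ∈ 𝓝 (theta1 α μ) :=
    Ioo_mem_nhds (by linarith) (by linarith)
  have hs := sin_theta1_pos hα hμ
  have hd1 : HasDerivAt M (deriv M (theta1 α μ)) (theta1 α μ) :=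
    ((hM.differentiableOn (by simp)).differentiableAt hnhds).hasDerivAt
  have hM' := ((contDiffOn_infty_iff_deriv_of_isOpen isOpen_Ioo).1 hM).2
  have hd2 : HasDerivAt (deriv M) (deriv (deriv M) (theta1 α μ)) (theta1 α μ) :=
    ((hM'.differentiableOn (by simp)).differentiableAt hnhds).hasDerivAt
  have hp : HasDerivAt (pPlus α μ) (-gap α μ) (theta1 α μ) := by
    rw [← deriv_pPlus_theta1 hα hμ]
    exact (hasDerivAt_pPlus α μ _).differentiableAt.hasDerivAt
  have ha : HasDerivAt (relaxRate α μ) (deriv (relaxRate α μ) (theta1 α μ)) (theta1 α μ) := by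
    refine DifferentiableAt.hasDerivAt ?_
    unfold relaxRate cPlus
    fun_prop
  have hsin := (Real.hasDerivAt_sin (theta1 α μ)).inv hs.ne'
  have hL := hp.mul hd2
  have hR := ha.mul (hsin.sub hd1)
  have heq : (pPlus α μ * deriv M) =ᶠ[𝓝 (theta1 α μ)]
      (relaxRate α μ * (Real.sin⁻¹ - M)) := by
    filter_upwards [hnhds] with θ hθ
    simpa using hode θ hθ
  have := hL.unique (hR.congr_of_eventuallyEq heq)
  simp only [Pi.sub_apply, Pi.inv_apply, hM1, relaxRate_theta1 hα hμ, pPlus_theta1 hα hμ, one_div,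
    sub_self, zero_mul, mul_zero, add_zero, zero_add] at this
  rw [eq_div_iff (by linarith)]
  have hc : Real.cos (theta1 α μ) / Real.sin (theta1 α μ) ^ 2 * slope α μ = phi1 α μ ^ 2 := by
    rw [phi1_sq hα hμ]
    have h1 := sin_theta1 α μ
    field_simp
    linear_combination -h1
  rw [neg_div] at this
  linear_combination (-1 : ℝ) * this + 2 * hc

/-- The invariant curve crosses `b = 0`, that is `φ² = 1 / sin θ`, only at `θ₁`. -/
lemma eventually_curve_sign {α μ : ℝ} {M : ℝ → ℝ} (hα : 0 < α) (hμ : muP α < μ)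
    (hd : DifferentiableAt ℝ M (theta1 α μ)) (hpos : 0 < deriv M (theta1 α μ))
    (hM1 : M (theta1 α μ) = 1 / Real.sin (theta1 α μ)) :
    ∀ᶠ θ in 𝓝 (theta1 α μ), (θ < theta1 α μ → M θ < 1 / Real.sin θ) ∧
      (theta1 α μ < θ → 1 / Real.sin θ < M θ) := by
  have hs := sin_theta1_pos hα hμ
  have hsin := (Real.hasDerivAt_sin (theta1 α μ)).inv hs.ne'
  have h := hsin.sub hd.hasDerivAt
  have hneg : deriv (Real.sin⁻¹ - M) (theta1 α μ) < 0 := by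
    rw [h.deriv, neg_div]
    have := div_pos (cos_theta1_pos α μ) (pow_pos hs 2)
    linarith
  filter_upwards [eventually_nhdsWithin_sign_eq_of_deriv_neg hneg (by simp [hM1])] with θ hθ
  constructor
  · intro hlt
    rw [sign_pos (sub_pos.2 hlt), sign_eq_one_iff] at hθ
    simpa using hθ
  · intro hlt
    rw [sign_neg (sub_neg.2 hlt), sign_eq_neg_one_iff] at hθ
    simpa using hθ

lemma eventually_isInvariantCurve {α μ δ r : ℝ} {M : ℝ → ℝ} (hα : 0 < α) (hμ : muP α < μ)
    (hδ0 : 0 < δ) (hδ : δ < phi1 α μ)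
    (hspeed : 2 * slope α μ * phi1 α μ < gap α μ * (phi1 α μ - δ)) (hr : 0 < r)
    (hξ : 2 * slope α μ < gap α μ)
    (hM : ContDiffOn ℝ ∞ M (Ioo (theta1 α μ - r) (theta1 α μ + r)))
    (hM1 : M (theta1 α μ) = 1 / Real.sin (theta1 α μ))
    (hode : ∀ θ ∈ Ioo (theta1 α μ - r) (theta1 α μ + r),
      pPlus α μ θ * deriv M θ = relaxRate α μ θ * (1 / Real.sin θ - M θ)) :
    ∀ᶠ c in 𝓝[>] (0 : ℝ), IsInvariantCurve α μ c δ M := by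
  have hnhds : Ioo (theta1 α μ - r) (theta1 α μ + r) ∈ 𝓝 (theta1 α μ) :=
    Ioo_mem_nhds (by linarith) (by linarith)
  have hdiff := (hM.differentiableOn (by simp)).differentiableAt hnhds
  have hpos : 0 < deriv M (theta1 α μ) := by
    rw [deriv_curve hα hμ hr hξ hM hM1 hode]
    have := phi1_pos hα hμ
    exact div_pos (by positivity) (by linarith)
  have h1 : ∀ᶠ θ in 𝓝 (theta1 α μ), M θ ∈ Ioo ((phi1 α μ - δ) ^ 2) ((phi1 α μ + δ) ^ 2) := by
    have := target_mem_Ioo hα hμ hδ0 hδ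
    rw [← hM1] at this
    exact hdiff.continuousAt.eventually_mem (Ioo_mem_nhds this.1 this.2)
  -- a bound strictly between the two rates `2 tan θ₁` and `gap` at `P`
  have h2 : ∀ᶠ θ in 𝓝 (theta1 α μ), relaxRate α μ θ < (2 * slope α μ + gap α μ) / 2 :=
    (continuous_relaxRate α μ).continuousAt.eventually_lt_const
      (by rw [relaxRate_theta1 hα hμ]; linarith)
  filter_upwards [eventually_forall_Icc
    (h1.and (h2.and ((eventually_curve_sign hα hμ hdiff hpos hM1).and hnhds)))] with c hc
  have hsub : Icc (theta1 α μ - c) (theta1 α μ + c) ⊆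
      Ioo (theta1 α μ - r) (theta1 α μ + r) := fun θ hθ => (hc θ hθ).2.2.2
  exact
    { smooth := hM.mono hsub
      hasDerivAt := fun θ hθ => ((hM.differentiableOn (by simp)).differentiableAt
        (isOpen_Ioo.mem_nhds (hsub hθ))).hasDerivAt
      ode := fun θ hθ => hode θ (hsub hθ)
      value := hM1
      mem := fun θ hθ => Ioo_subset_Icc_self (hc θ hθ).1
      lt_left := fun θ hθ => (hc θ hθ).2.2.1.1
      lt_right := fun θ hθ => (hc θ hθ).2.2.1.2
      rate_lt := ⟨(2 * slope α μ + gap α μ) / 2, by linarith, fun θ hθ => (hc θ hθ).2.1.le⟩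
      speed := hspeed }

/-- Taylor's estimate of order two, on both sides of the base point. -/
lemma exists_quadratic_bound {f : ℝ → ℝ} {a c r : ℝ} (hc : 0 < c) (hcr : c < r)
    (hf : ContDiffOn ℝ 2 f (Ioo (a - r) (a + r))) :
    ∃ K : ℝ, ∀ θ ∈ Icc (a - c) (a + c),
      |f θ - (f a + deriv f a * (θ - a))| ≤ K * (θ - a) ^ 2 := by
  have hsub : Icc (a - c) (a + c) ⊆ Ioo (a - r) (a + r) :=
    Icc_subset_Ioo (by linarith) (by linarith)
  have ha : a ∈ Icc (a - c) (a + c) := ⟨by linarith, by linarith⟩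
  have hf' : ContDiffOn ℝ 1 (deriv f) (Ioo (a - r) (a + r)) :=
    ((contDiffOn_succ_iff_deriv_of_isOpen isOpen_Ioo).1
      (by rwa [one_add_one_eq_two])).2.2
  obtain ⟨K, hK0, hK⟩ := exists_bound_of_contDiffOn (hf'.mono hsub) (convex_Icc _ _)
    isCompact_Icc ha
  refine ⟨K, fun θ hθ => ?_⟩
  have hseg : uIcc a θ ⊆ Icc (a - c) (a + c) := uIcc_subset_Icc ha hθ
  have h := Convex.norm_image_sub_le_of_norm_hasDerivWithin_le (s := uIcc a θ)
    (f := fun t => f t - deriv f a * t) (f' := fun t => deriv f t - deriv f a)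
    (C := K * |θ - a|) (x := a) (y := θ)
    (fun t ht => ((((hf.differentiableOn (by norm_num)).differentiableAt
      (isOpen_Ioo.mem_nhds (hsub (hseg ht)))).hasDerivAt.sub
        ((hasDerivAt_id t).const_mul (deriv f a))).hasDerivWithinAt).congr_deriv (by simp))
    (fun t ht => (hK t (hseg ht)).trans
      (mul_le_mul_of_nonneg_left (abs_sub_left_of_mem_uIcc ht) hK0))
    (convex_uIcc a θ) left_mem_uIcc right_mem_uIcc
  simp only [Real.norm_eq_abs] at h
  rw [mul_assoc, abs_mul_abs_self] at h
  convert h using 2 <;> ring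

/-- In the coordinate `φ` the invariant curve has the slope `(1 - ξ)⁻¹ s` of the strong
eigendirection at `P`. -/
lemma eventually_sqrt_curve_bound {α μ r : ℝ} {M : ℝ → ℝ} (hα : 0 < α) (hμ : muP α < μ)
    (hr : 0 < r) (hξ : 2 * slope α μ < gap α μ)
    (hM : ContDiffOn ℝ ∞ M (Ioo (theta1 α μ - r) (theta1 α μ + r)))
    (hM1 : M (theta1 α μ) = 1 / Real.sin (theta1 α μ))
    (hode : ∀ θ ∈ Ioo (theta1 α μ - r) (theta1 α μ + r),
      pPlus α μ θ * deriv M θ = relaxRate α μ θ * (1 / Real.sin θ - M θ)) :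
    ∀ᶠ c in 𝓝[>] (0 : ℝ), ∃ K : ℝ, ∀ θ ∈ Icc (theta1 α μ - c) (theta1 α μ + c),
      |Real.sqrt (M θ) - (phi1 α μ + (1 - xi α μ)⁻¹ * sCoeff α μ * (θ - theta1 α μ))| ≤
        K * (θ - theta1 α μ) ^ 2 := by
  have hnhds : Ioo (theta1 α μ - r) (theta1 α μ + r) ∈ 𝓝 (theta1 α μ) :=
    Ioo_mem_nhds (by linarith) (by linarith)
  have hdiff := (hM.differentiableOn (by simp)).differentiableAt hnhds
  have hMpos : 0 < M (theta1 α μ) := by rw [hM1]; exact one_div_pos.2 (sin_theta1_pos hα hμ)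
  obtain ⟨ρ, hρ, hball⟩ := Metric.eventually_nhds_iff_ball.1
    ((hdiff.continuousAt.eventually_const_lt hMpos).and hnhds)
  rw [Real.ball_eq_Ioo] at hball
  have hsm : ContDiffOn ℝ 2 (fun θ => Real.sqrt (M θ))
      (Ioo (theta1 α μ - ρ) (theta1 α μ + ρ)) :=
    ((contDiffOn_infty.1 hM 2).mono fun θ hθ => (hball θ hθ).2).sqrt
      fun θ hθ => (hball θ hθ).1.ne'
  have hval : Real.sqrt (M (theta1 α μ)) = phi1 α μ := by rw [hM1]; rfl
  have hder : deriv (fun θ => Real.sqrt (M θ)) (theta1 α μ) =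
      (1 - xi α μ)⁻¹ * sCoeff α μ := by
    rw [(hdiff.hasDerivAt.sqrt hMpos.ne').deriv, hval, deriv_curve hα hμ hr hξ hM hM1 hode,
      xi_eq hα hμ, sCoeff_eq hα hμ]
    have h1 := (gap_pos hα hμ).ne'
    have h2 := (phi1_pos hα hμ).ne'
    have h3 : gap α μ - 2 * slope α μ ≠ 0 := by linarith
    field_simp
  filter_upwards [Ioo_mem_nhdsGT hρ] with c hc
  obtain ⟨K, hK⟩ := exists_quadratic_bound hc.1 hc.2 hsm
  rw [hval, hder] at hK
  exact ⟨K, hK⟩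

/-- A half-height so small that on the rectangle the decay of `θ - θ₁` in the time `τ` is faster
than `exp (λ₂ τ)`. -/
lemma exists_half_height {α μ ε : ℝ} (hα : 0 < α) (hμ : muP α < μ) (hε : 0 < ε) :
    ∃ δ > 0, δ < phi1 α μ ∧ δ < ε ∧ (2 * slope α μ < gap α μ →
      2 * slope α μ * phi1 α μ < gap α μ * (phi1 α μ - δ)) := by
  have hφ := phi1_pos hα hμ
  have h1 : ∀ᶠ δ in 𝓝[>] (0 : ℝ), 2 * slope α μ < gap α μ →
      2 * slope α μ * phi1 α μ < gap α μ * (phi1 α μ - δ) := by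
    by_cases h : 2 * slope α μ < gap α μ
    · have hc : ContinuousAt (fun δ => gap α μ * (phi1 α μ - δ)) 0 := by fun_prop
      filter_upwards [(hc.eventually_const_lt (u := 2 * slope α μ * phi1 α μ)
        (by simpa using mul_lt_mul_of_pos_right h hφ)).filter_mono nhdsWithin_le_nhds]
        with δ hδ _ using hδ
    · exact Eventually.of_forall fun δ h' => absurd h' h
  have h2 : ∀ᶠ δ in 𝓝[>] (0 : ℝ), δ ∈ Ioo 0 (phi1 α μ) := Ioo_mem_nhdsGT hφ
  have h3 : ∀ᶠ δ in 𝓝[>] (0 : ℝ), δ ∈ Ioo 0 ε := Ioo_mem_nhdsGT hε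
  obtain ⟨δ, hδ1, hδ2, hδ3⟩ := (h1.and (h2.and h3)).exists
  exact ⟨δ, hδ2.1, hδ2.2, hδ3.2, hδ1⟩

/-- Arbitrarily small trapping rectangles, which for `ξ < 1` carry an invariant curve. -/
lemma exists_box {α μ : ℝ} (hα : 0 < α) (hμ : muP α < μ) {V : Set (ℝ × ℝ)}
    (hV : V ∈ 𝓝 (pointP α μ)) :
    ∃ c δ, IsTrapping α μ c δ ∧ box α μ c δ ⊆ V ∧
      (xi α μ < 1 → ∃ M, IsInvariantCurve α μ c δ M ∧
        ∃ K : ℝ, ∀ θ ∈ Icc (theta1 α μ - c) (theta1 α μ + c),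
          |Real.sqrt (M θ) - (phi1 α μ + (1 - xi α μ)⁻¹ * sCoeff α μ * (θ - theta1 α μ))| ≤
            K * (θ - theta1 α μ) ^ 2) := by
  obtain ⟨ε, hε, hball⟩ := Metric.nhds_basis_closedBall.mem_iff.1 hV
  obtain ⟨δ, hδ0, hδφ, hδε, hspeed⟩ := exists_half_height hα hμ hε
  have hbox : ∀ᶠ c in 𝓝[>] (0 : ℝ), box α μ c δ ⊆ V := by
    filter_upwards [Ioo_mem_nhdsGT hε] with c hc x hx
    refine hball ?_
    rw [Metric.mem_closedBall, Prod.dist_eq, max_le_iff, Real.dist_eq, Real.dist_eq, abs_le, abs_le]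
    have h1 := hx.1
    have h2 := hx.2
    simp only [pointP]
    refine ⟨⟨?_, ?_⟩, ?_, ?_⟩ <;> linarith [h1.1, h1.2, h2.1, h2.2, hc.2]
  by_cases hξ : xi α μ < 1
  · obtain ⟨M, r, hr, hM, hM1, hode⟩ := exists_invariant_curve hα hμ hξ
    have hξ' := (xi_lt_one_iff hα hμ).1 hξ
    obtain ⟨c, h1, h2, h3, h4⟩ := ((eventually_isTrapping hα hμ hδ0 hδφ).and (hbox.and
      ((eventually_isInvariantCurve hα hμ hδ0 hδφ (hspeed hξ') hr hξ' hM hM1 hode).and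
        (eventually_sqrt_curve_bound hα hμ hr hξ' hM hM1 hode)))).exists
    exact ⟨c, δ, h1, h2, fun _ => ⟨M, h3, h4⟩⟩
  · obtain ⟨c, h1, h2⟩ := ((eventually_isTrapping hα hμ hδ0 hδφ).and hbox).exists
    exact ⟨c, δ, h1, h2, fun h => absurd h hξ⟩

lemma box_mem_nhds {α μ c δ : ℝ} (H : IsTrapping α μ c δ) :
    box α μ c δ ∈ 𝓝 (pointP α μ) := by
  have hc := H.c_pos
  have hδ := H.δ_pos
  exact prod_mem_nhds (Icc_mem_nhds (by simpa [pointP] using hc) (by simpa [pointP] using hc))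
    (Icc_mem_nhds (by simpa [pointP] using hδ) (by simpa [pointP] using hδ))

lemma curve_mem_regions {α μ c δ : ℝ} {M : ℝ → ℝ} (hα : 0 < α) (hμ : muP α < μ)
    (H : IsTrapping α μ c δ) (HM : IsInvariantCurve α μ c δ M) :
    ∀ θ ∈ Icc (theta1 α μ - c) (theta1 α μ + c), (θ, Real.sqrt (M θ)) ∈
      regionT α μ (box α μ c δ) ∪ {pointP α μ} ∪ regionF α μ (box α μ c δ) := by
  intro θ hθ
  have hb : b θ (Real.sqrt (M θ)) = Real.sin θ * (M θ - 1 / Real.sin θ) := by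
    rw [b_eq_sin_mul (H.sin_pos hθ).ne', Real.sq_sqrt (HM.pos H θ hθ).le]
  have hm := mem_box_of_curve H HM hθ
  rcases lt_trichotomy θ (theta1 α μ) with h | h | h
  · refine Or.inl (Or.inl ⟨⟨?_, (H.pPlus_pos_iff hα hμ hθ).2 h⟩, hm⟩)
    simp only [hb]
    exact mul_neg_of_pos_of_neg (H.sin_pos hθ) (sub_neg.2 (HM.lt_left θ hθ h))
  · refine Or.inl (Or.inr ?_)
    rw [h, HM.value]
    rfl
  · refine Or.inr ⟨⟨?_, (H.pPlus_neg_iff hα hμ hθ).2 h⟩, hm⟩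
    simp only [hb]
    exact mul_pos (H.sin_pos hθ) (sub_pos.2 (HM.lt_right θ hθ h))

end

end PainleveRod

open PainleveRod
theorem mainTheorem3 (α μ : ℝ) (hα : 0 < α) (hμ : muP α < μ) :
    -- the time change `dτ/dt = 1 / p₊` turns the reduced system into the desingularized one
    (∀ x : ℝ × ℝ, pPlus α μ x.1 ≠ 0 →
      desingularizedField α μ x = pPlus α μ x.1 • reducedField α μ x) ∧
    -- `P` lies on `b = 0`, `p₊ = 0`, and is a stable node
    (b (theta1 α μ) (phi1 α μ) = 0 ∧ pPlus α μ (theta1 α μ) = 0) ∧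
    IsStableNode (desingularizedField α μ) (pointP α μ) ∧
    (lam1 α μ < 0 ∧ lam2 α μ < 0 ∧ 0 < xi α μ ∧ 0 < sCoeff α μ) ∧
    -- `(1 - ξ, s)` and `(0, 1)` are the eigendirections at `P`
    Module.End.HasEigenvector
      (fderiv ℝ (desingularizedField α μ) (pointP α μ) : ℝ × ℝ →ₗ[ℝ] ℝ × ℝ)
      (lam1 α μ) (1 - xi α μ, sCoeff α μ) ∧
    Module.End.HasEigenvector
      (fderiv ℝ (desingularizedField α μ) (pointP α μ) : ℝ × ℝ →ₗ[ℝ] ℝ × ℝ)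
      (lam2 α μ) (0, 1) ∧
    (muC α < μ ↔ xi α μ < 1) ∧
    -- arbitrarily small neighbourhoods `U` of `P` with the following properties
    ∀ V ∈ 𝓝 (pointP α μ), ∃ U ∈ 𝓝 (pointP α μ), U ⊆ V ∧
      -- in the time `τ`, all forward orbits from `U` stay in `U` and converge to `P`
      (∀ x ∈ U, ∃ X : ℝ → ℝ × ℝ, X 0 = x ∧
        IsSolutionOn (desingularizedField α μ) X (Ici 0) ∧ (∀ τ ∈ Ici (0 : ℝ), X τ ∈ U) ∧
        Tendsto X atTop (𝓝 (pointP α μ))) ∧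
      -- the strong stable manifold and the fate of the points of `𝓣`
      (muC α < μ →
        ∃ c > 0, ∃ m : ℝ → ℝ,
          (∀ x ∈ U, x.1 ∈ Icc (theta1 α μ - c) (theta1 α μ + c)) ∧
          ContDiffOn ℝ ∞ m (Icc (theta1 α μ - c) (theta1 α μ + c)) ∧
          (fun θ => (θ, m θ)) '' Icc (theta1 α μ - c) (theta1 α μ + c) =
            localStrongStableSet (desingularizedField α μ) (pointP α μ) (lam2 α μ) U ∧
          (∀ θ ∈ Icc (theta1 α μ - c) (theta1 α μ + c),
            (θ, m θ) ∈ regionT α μ U ∪ {pointP α μ} ∪ regionF α μ U) ∧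
          (∃ K : ℝ, ∀ θ ∈ Icc (theta1 α μ - c) (theta1 α μ + c),
            |m θ - (phi1 α μ + (1 - xi α μ)⁻¹ * sCoeff α μ * (θ - theta1 α μ))| ≤
              K * (θ - theta1 α μ) ^ 2) ∧
          (∀ x ∈ regionT α μ U, m x.1 < x.2 → LeavesThroughLiftOff α μ U x) ∧
          (∀ x ∈ regionT α μ U, x.2 < m x.1 → LeavesThroughPVertically α μ U x)) := by
  refine ⟨?_, ⟨b_pointP hα hμ, pPlus_theta1 hα hμ⟩, isStableNode_pointP hα hμ,
    ⟨lam1_neg hα hμ, lam2_neg hα hμ, xi_pos hα hμ, sCoeff_pos hα hμ⟩,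
    hasEigenvector_lam1 hα hμ, hasEigenvector_lam2 hα hμ, muC_lt_iff_xi_lt_one hα hμ, ?_⟩
  · intro x hx
    simp only [desingularizedField, reducedField, Prod.smul_mk, smul_eq_mul, Prod.mk.injEq,
      true_and]
    field_simp
  intro V hV
  obtain ⟨c, δ, H, hUV, hcurve⟩ := exists_box hα hμ hV
  refine ⟨box α μ c δ, box_mem_nhds H, hUV, ?_, ?_⟩
  · intro x hx
    obtain ⟨X, h1, h2, h3, h4, -⟩ := exists_desingularized_orbit hα hμ H hx
    exact ⟨X, h1, h2, h3, h4⟩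
  · intro hC
    obtain ⟨M, HM, hK⟩ := hcurve ((muC_lt_iff_xi_lt_one hα hμ).1 hC)
    have hMpos := HM.pos H
    refine ⟨c, H.c_pos, fun θ => Real.sqrt (M θ), fun x hx => hx.1,
      HM.smooth.sqrt fun θ hθ => (hMpos θ hθ).ne', image_curve_eq hα hμ H HM,
      curve_mem_regions hα hμ H HM, hK, ?_, ?_⟩
    · intro x hx hlt
      refine leavesThroughLiftOff_of_lt hα hμ H HM hx ?_
      exact (Real.sqrt_lt' (H.snd_pos hx.2)).1 hlt
    · intro x hx hlt
      refine leavesThroughPVertically_of_lt hα hμ H HM hx ?_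
      exact (Real.lt_sqrt (H.snd_pos hx.2).le).1 hlt
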